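/- Let $G$ be a finite group, and let $\hat G$ be a set of representatives of the unitary equivalence classes of irreducible unitary representations $\pi$ of $G$ on finite-dimensional Hilbert spaces $H_\pi$, chosen so that it contains the trivial representation $\mathbf 1$ on $\mathbb C$. For $\pi,\rho,\sigma\in\hat G$ let $(\sigma,\pi\otimes\rho)$ be the space of linear maps $T:H_\sigma\to H_\pi\otimes H_\rho$ with $T\sigma(g)=(\pi(g)\otimes\rho(g))T$ for all $g\in G$; such a $T$ is identified with $1_M\otimes T$ below. Let $M$ be a factor of type $\mathrm{II}_1$, that is, an infinite-dimensional von Neumann algebra factor with a faithful normal tracial state. An action $\alpha$ of $\hat G$ on $M$ is a family of unital $*$-homomorphisms $\alpha_\pi:M\to M\otimes B(H_\pi)$, $\pi\in\hat G$, such that $\alpha_{\mathbf 1}=\mathrm{id}_M$ and $$(\alpha_\pi\otimes\mathrm{id}_\rho)(\alpha_\rho(x))\,T=T\,\alpha_\sigma(x)\qquad\text{for all }x\in M,\ \pi,\rho,\sigma\in\hat G,\ T\in(\sigma,\pi\otimes\rho).$$ The action is outer if for every $\pi\in\hat G$ with $\pi\neq\mathbf 1$ the only $a\in M\otimes B(H_\pi)$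 with $\alpha_\pi(x)a=a(x\otimes 1_\pi)$ for all $x\in M$ is $a=0$. A unitary 1-cocycle for $\alpha$ is a family of unitaries $w_\pi\in M\otimes B(H_\pi)$, $\pi\in\hat G$, such that $w_{\mathbf 1}=1$ and $$(w_\pi\otimes 1_\rho)\,(\alpha_\pi\otimes\mathrm{id}_\rho)(w_\rho)\,T=T\,w_\sigma\qquad\text{for all }\pi,\rho,\sigma\in\hat G,\ T\in(\sigma,\pi\otimes\rho).$$ Let $\alpha$ be an outer action of $\hat G$ on $M$. Then every unitary 1-cocycle $\{w_\pi\}_{\pi\in\hat G}$ for $\alpha$ is a coboundary: there is a unitary $v\in M$ such that $$w_\pi=(v^*\otimes 1_\pi)\,\alpha_\pi(v)\qquad\text{for all }\pi\in\hat G.$$ -/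

import Mathlib

open scoped Matrix Kronecker InnerProductSpace

noncomputable section

universe u v

/-! ### Finite dimensional unitary representations and the dual of a finite group -/

/-- A finite dimensional unitary representation `π` of `G`, on the Hilbert space `H_π = ℂ ^ dim`
with its standard orthonormal basis; `B(H_π)` is the algebra of `dim × dim` matrices. -/
structure UnitaryRep (G : Type u) [Group G] where
  /-- The dimension `d π`. -/
  dim : ℕ
  /-- The homomorphism `g ↦ π(g)`. -/
  toHom : G →* Matrix.unitaryGroup (Fin dim) ℂ

namespace UnitaryRep

variable {G : Type u} [Group G]

/-- The unitary matrix `π(g)`. -/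
def mat (π : UnitaryRep G) (g : G) : Matrix (Fin π.dim) (Fin π.dim) ℂ :=
  (π.toHom g : Matrix (Fin π.dim) (Fin π.dim) ℂ)

/-- The underlying linear representation on `ℂ ^ dim`. -/
def toRepresentation (π : UnitaryRep G) : Representation ℂ G (Fin π.dim → ℂ) :=
  ((Matrix.toLinAlgEquiv' : Matrix (Fin π.dim) (Fin π.dim) ℂ ≃ₐ[ℂ] _) :
      Matrix (Fin π.dim) (Fin π.dim) ℂ →* _).comp
    ((Matrix.unitaryGroup (Fin π.dim) ℂ).subtype.comp π.toHom)

/-- Irreducibility (in particular `dim ≠ 0`). -/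
def Irreducible (π : UnitaryRep G) : Prop :=
  π.toRepresentation.IsIrreducible

/-- Unitary equivalence of representations. -/
def Equivalent (π ρ : UnitaryRep G) : Prop :=
  ∃ U : Matrix (Fin ρ.dim) (Fin π.dim) ℂ,
    Uᴴ * U = 1 ∧ U * Uᴴ = 1 ∧ ∀ g, U * π.mat g = ρ.mat g * U

/-- The trivial representation on `ℂ`. -/
def trivial (G : Type u) [Group G] : UnitaryRep G where
  dim := 1
  toHom := 1

/-- `T ∈ (σ, π ⊗ ρ)`: the matrix `T` intertwines `σ` and `π ⊗ ρ`. -/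
def IsIntertwinerToTensor (σ π ρ : UnitaryRep G)
    (T : Matrix (Fin π.dim × Fin ρ.dim) (Fin σ.dim) ℂ) : Prop :=
  ∀ g, T * σ.mat g = (π.mat g ⊗ₖ ρ.mat g) * T

end UnitaryRep

/-- A choice of dual `Ĝ`: a set of representatives of the unitary equivalence classes of
irreducible unitary representations which contains the trivial representation. -/
structure UnitaryDual (G : Type u) [Group G] where
  carrier : Set (UnitaryRep G)
  irreducible : ∀ π ∈ carrier, π.Irreducible
  eq_of_equivalent : ∀ π ∈ carrier, ∀ ρ ∈ carrier, π.Equivalent ρ → π = ρ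
  exists_equivalent : ∀ π : UnitaryRep G, π.Irreducible → ∃ ρ ∈ carrier, π.Equivalent ρ
  trivial_mem : UnitaryRep.trivial G ∈ carrier

namespace UnitaryDual

variable {G : Type u} [Group G]

/-- The type of elements of `Ĝ`. -/
abbrev Elt (D : UnitaryDual G) : Type u := {π : UnitaryRep G // π ∈ D.carrier}

/-- The trivial representation as an element of `Ĝ`. -/
def triv (D : UnitaryDual G) : D.Elt := ⟨UnitaryRep.trivial G, D.trivial_mem⟩

/-- The index set of the fixed orthonormal basis of `H_π`. -/
abbrev Idx (D : UnitaryDual G) (π : D.Elt) : Type := Fin π.1.dim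

end UnitaryDual

/-! ### Factors of type II₁ -/

namespace VonNeumannAlgebra

variable {H : Type v} [NormedAddCommGroup H] [InnerProductSpace ℂ H] [CompleteSpace H]

/-- The `*`-algebra of elements of `M`. -/
abbrev Elt (M : VonNeumannAlgebra H) : Type v := M.toStarSubalgebra

/-- `M` is a factor: its center consists of the scalars. -/
def IsFactor (M : VonNeumannAlgebra H) : Prop :=
  ∀ x : M.Elt, (∀ y : M.Elt, x * y = y * x) → ∃ c : ℂ, x = algebraMap ℂ M.Elt c

/-- `τ` is a faithful normal tracial state on `M`. Normality is the last clause: `τ` is a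
countable sum `∑ ⟪ξ n, · ξ n⟫` of vector functionals with `∑ ‖ξ n‖ ^ 2 < ∞`; this also gives
positivity. -/
structure IsFaithfulNormalTracialState (M : VonNeumannAlgebra H) (τ : M.Elt →ₗ[ℂ] ℂ) : Prop where
  map_one : τ 1 = 1
  tracial : ∀ x y : M.Elt, τ (x * y) = τ (y * x)
  faithful : ∀ x : M.Elt, τ (star x * x) = 0 → x = 0
  normal : ∃ ξ : ℕ → H, Summable (fun n => ‖ξ n‖ ^ 2) ∧
    ∀ x : M.Elt, HasSum (fun n => ⟪ξ n, (x : H →L[ℂ] H) (ξ n)⟫_ℂ) (τ x)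

/-- `M` is a factor of type II₁: an infinite dimensional factor with a faithful normal tracial
state. -/
structure IsTypeIIOneFactor (M : VonNeumannAlgebra H) : Prop where
  isFactor : M.IsFactor
  infinite_dimensional : ¬ FiniteDimensional ℂ M.Elt
  exists_trace : ∃ τ : M.Elt →ₗ[ℂ] ℂ, M.IsFaithfulNormalTracialState τ

end VonNeumannAlgebra

/-! ### Actions of `Ĝ`

`M ⊗ B(H_π)` is the `*`-algebra of matrices over `M` indexed by the orthonormal basis of `H_π`;
`M ⊗ B(H_π) ⊗ B(H_ρ)` is that of matrices indexed by pairs. -/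

section Actions

variable {G : Type u} [Group G] {H : Type v} [NormedAddCommGroup H] [InnerProductSpace ℂ H]
  [CompleteSpace H]

/-- The scalar matrix `T` regarded as `1_M ⊗ T`. -/
def oneTensor {m n : Type} (M : VonNeumannAlgebra H) (T : Matrix m n ℂ) : Matrix m n M.Elt :=
  T.map (algebraMap ℂ M.Elt)

/-- The map `φ ⊗ id : M ⊗ B(ℂ^n) → M ⊗ B(ℂ^m) ⊗ B(ℂ^n)` for `φ : M → M ⊗ B(ℂ^m)`. -/
def tensorId {m n : Type} {M : VonNeumannAlgebra H} (φ : M.Elt → Matrix m m M.Elt)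
    (A : Matrix n n M.Elt) : Matrix (m × n) (m × n) M.Elt :=
  Matrix.of fun p q => φ (A p.2 q.2) p.1 q.1

/-- An action of `Ĝ` on `M`: unital `*`-homomorphisms `α_π : M → M ⊗ B(H_π)` with
`α_𝟏 = id` and `(α_π ⊗ id_ρ)(α_ρ(x)) T = T α_σ(x)` for every `T ∈ (σ, π ⊗ ρ)`. -/
structure DualAction (D : UnitaryDual G) (M : VonNeumannAlgebra H) where
  map : ∀ π : D.Elt, M.Elt →⋆ₐ[ℂ] Matrix (D.Idx π) (D.Idx π) M.Elt
  map_triv : ∀ x : M.Elt, map D.triv x = Matrix.scalar (D.Idx D.triv) x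
  map_tensor : ∀ (π ρ σ : D.Elt) (T : Matrix (D.Idx π × D.Idx ρ) (D.Idx σ) ℂ),
    σ.1.IsIntertwinerToTensor π.1 ρ.1 T → ∀ x : M.Elt,
      tensorId (map π) (map ρ x) * oneTensor M T = oneTensor M T * map σ x

namespace DualAction

variable {D : UnitaryDual G} {M : VonNeumannAlgebra H}

/-- Freeness: for `π ≠ 𝟏`, no non-zero `a ∈ M ⊗ B(H_π)` satisfies `α_π(x) a = a (x ⊗ 1_π)` for
all `x ∈ M`. A free action on a factor is called outer. -/
def IsFree (α : DualAction D M) : Prop :=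
  ∀ π : D.Elt, π ≠ D.triv → ∀ a : Matrix (D.Idx π) (D.Idx π) M.Elt,
    (∀ x : M.Elt, α.map π x * a = a * Matrix.scalar (D.Idx π) x) → a = 0

/-- An outer action is a free action on a factor. -/
def IsOuter (α : DualAction D M) : Prop :=
  M.IsFactor ∧ α.IsFree

/-- `{w_π}` is a unitary 1-cocycle for `α`: each `w_π ∈ M ⊗ B(H_π)` is unitary, `w_𝟏 = 1`, and
`(w_π ⊗ 1_ρ) (α_π ⊗ id_ρ)(w_ρ) T = T w_σ` for every `T ∈ (σ, π ⊗ ρ)`. -/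
structure IsUnitaryOneCocycle (α : DualAction D M)
    (w : ∀ π : D.Elt, Matrix (D.Idx π) (D.Idx π) M.Elt) : Prop where
  unitary : ∀ π, w π ∈ unitary (Matrix (D.Idx π) (D.Idx π) M.Elt)
  triv : w D.triv = 1
  cocycle : ∀ (π ρ σ : D.Elt) (T : Matrix (D.Idx π × D.Idx ρ) (D.Idx σ) ℂ),
    σ.1.IsIntertwinerToTensor π.1 ρ.1 T →
      (w π ⊗ₖ (1 : Matrix (D.Idx ρ) (D.Idx ρ) M.Elt)) * tensorId (α.map π) (w ρ) * oneTensor M T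
        = oneTensor M T * w σ

/-- `{w_π}` is a coboundary for `α`: `w_π = (v* ⊗ 1_π) α_π(v)` for a unitary `v ∈ M`. -/
def IsCoboundary (α : DualAction D M)
    (w : ∀ π : D.Elt, Matrix (D.Idx π) (D.Idx π) M.Elt) : Prop :=
  ∃ v ∈ unitary M.Elt, ∀ π : D.Elt,
    w π = Matrix.scalar (D.Idx π) (star v) * α.map π v

end DualAction

end Actions

end

/-!
Let `x_g` denote the components of `x ∈ M` under the Fourier transform of `G`: since a function on
`G` is determined by its Fourier coefficients and `Ĝ` is finite, there are unique `x_g ∈ M` with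
`α_π(x) = ∑ g, x_g ⊗ π(g)` for all `π`. By the axioms of an action, the maps `x ↦ x_g` are the
projections of a `G`-grading of the `*`-algebra `M` (`DualAction.isGrading`). In the same way a
unitary cocycle `w` is a function `g ↦ w_g` on `G` with `∑ g, w_g = 1`, an orthogonality relation
expressing unitarity, and `w_g* w_h = (w_h)_{g⁻¹h}`; and `w` is the coboundary of `v` if and only if
`v_g = v w_g` for all `g`. By outerness, the only intertwiners between `M` acting on itself
from the right and the representation of `M` on `M ⊗ ℓ²(G)` given by the grading are the constant
scalar functions (`DualAction.IsOuter.isFreeGrading`).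

Let `X` be the space of all `v ∈ M` with `v_g = v w_g`. It is a ternary ring of operators,
`X X* X ⊆ X`, and it is closed in the `2`-norm on bounded sets, because the projections of the
grading are continuous there (`IsCompleteTrace.tendsto_grading`): `x ↦ τ(x_1)` is again a tracial
state, and on a finite factor all tracial states are controlled by the `2`-norm on bounded sets
(`IsCompleteTrace.re_tracialState_le`), by comparison of projections. Since `X` contains the polar
parts of its elements (obtained by the Newton–Schulz iteration, which stays inside `X`), a maximal
partial isometry `v ∈ X` satisfies `(1 - v v*) X (1 - v* v) = 0`
(`IsCompleteTrace.exists_maximal_partialIsometry`).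

Every `x ∈ M` gives an element `∑ h, x_h w_h*` of `X`, so with `p = 1 - v v*` and `q = 1 - v* v` one
has `p ∑ h, x_h w_h* q = 0` for all `x`. The averaging argument
`IsCompleteTrace.smul_eq_zero_of_relation` turns this relation into `τ(∑ h, w_h* q) p = 0`, that is
`τ(q) p = 0`: in the closed convex hull of the orbit of `(w_h* q)_h ∈ M ⊗ ℓ²(G)` under the unitaries
of `M` the element of least `2`-norm is an intertwiner, hence a constant scalar by freeness. As
`τ(p) = τ(q)` and `τ` is faithful, `p = q = 0` and `v` is a unitary
(`IsCompleteTrace.exists_unitary_of_cocycle`).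

Normality of the trace enters only through completeness of the unit ball of `M` in the `2`-norm
(`VonNeumannAlgebra.IsFaithfulNormalTracialState.exists_isCompleteTrace`), which allows one to work
with an abstract C*-algebra in between.
-/

noncomputable section

/-! ### Finite von Neumann algebras in standard form -/

section CompleteTrace

open Filter Topology

variable {A : Type*} [CStarAlgebra A] {E : Type*} [NormedAddCommGroup E] [InnerProductSpace ℂ E]

/-- `τ` is a faithful tracial state on the C*-algebra `A`, the linear map `ι` realises its `2`-norm
in the Hilbert space `E`, and norm-bounded sequences of `A` which converge in the `2`-norm of `E`
have their limit in `A`. The last property, which only involves `τ`, singles out the finite von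
Neumann algebras with a faithful normal tracial state among the C*-algebras with a faithful tracial
state. -/
structure IsCompleteTrace (τ : A →ₗ[ℂ] ℂ) (ι : A →ₗ[ℂ] E) : Prop where
  map_one : τ 1 = 1
  tracial : ∀ x y, τ (x * y) = τ (y * x)
  inner_map : ∀ x y, ⟪ι x, ι y⟫_ℂ = τ (star x * y)
  injective : ∀ x, ι x = 0 → x = 0
  complete : ∀ (C : ℝ) (x : ℕ → A) (ζ : E), (∀ n, ‖x n‖ ≤ C) →
    Tendsto (fun n => ι (x n)) atTop (𝓝 ζ) → ∃ y, ι y = ζ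

/-- The norm-bounded sequence `x` converges to `y` in the `2`-norm given by `ι`. -/
def IsBoundedLimit (ι : A →ₗ[ℂ] E) (x : ℕ → A) (y : A) : Prop :=
  (∃ C, ∀ n, ‖x n‖ ≤ C) ∧ Tendsto (fun n => ι (x n)) atTop (𝓝 (ι y))

namespace IsCompleteTrace

variable {τ : A →ₗ[ℂ] ℂ} {ι : A →ₗ[ℂ] E} (h : IsCompleteTrace τ ι)

include h

theorem norm_map_sq (x : A) : ‖ι x‖ ^ 2 = (τ (star x * x)).re := by
  rw [← h.inner_map, ← inner_self_eq_norm_sq (𝕜 := ℂ)]; rfl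

theorem apply_eq_inner (x : A) : τ x = ⟪ι 1, ι x⟫_ℂ := by
  rw [h.inner_map]; simp

theorem norm_map_star (x : A) : ‖ι (star x)‖ = ‖ι x‖ := by
  rw [← sq_eq_sq₀ (norm_nonneg _) (norm_nonneg _), h.norm_map_sq, h.norm_map_sq, star_star,
    h.tracial]

section Order

variable [PartialOrder A] [StarOrderedRing A]

theorem re_nonneg {x : A} (hx : 0 ≤ x) : 0 ≤ (τ x).re := by
  obtain ⟨y, rfl⟩ := CStarAlgebra.nonneg_iff_eq_star_mul_self.mp hx
  rw [← h.norm_map_sq]; positivity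

theorem re_mono {x y : A} (hxy : x ≤ y) : (τ x).re ≤ (τ y).re := by
  have := h.re_nonneg (sub_nonneg.mpr hxy)
  simpa using this

theorem re_mul_nonneg {x y : A} (hx : 0 ≤ x) (hy : 0 ≤ y) : 0 ≤ (τ (x * y)).re := by
  obtain ⟨z, rfl⟩ := CStarAlgebra.nonneg_iff_eq_star_mul_self.mp hx
  rw [mul_assoc, h.tracial]
  exact h.re_nonneg (star_right_conjugate_nonneg hy z)

theorem eq_zero_of_nonneg {x : A} (hx : 0 ≤ x) (h0 : (τ x).re = 0) : x = 0 := by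
  obtain ⟨y, rfl⟩ := CStarAlgebra.nonneg_iff_eq_star_mul_self.mp hx
  rw [← h.norm_map_sq] at h0
  rw [h.injective y (by simpa using h0), mul_zero]

end Order

theorem norm_map_mul_le (x y : A) : ‖ι (x * y)‖ ≤ ‖x‖ * ‖ι y‖ := by
  let _ : PartialOrder A := CStarAlgebra.spectralOrder A
  have _ : StarOrderedRing A := CStarAlgebra.spectralOrderedRing A
  rw [← sq_le_sq₀ (norm_nonneg _) (by positivity), mul_pow, h.norm_map_sq, h.norm_map_sq]
  have h1 : star (x * y) * (x * y) ≤ (‖x‖ ^ 2 : ℂ) • (star y * y) := by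
    have := star_left_conjugate_le_conjugate
      (CStarAlgebra.star_mul_le_algebraMap_norm_sq (a := x)) y
    calc star (x * y) * (x * y) = star y * (star x * x) * y := by simp [mul_assoc]
      _ ≤ _ := this
      _ = _ := by
        rw [Algebra.algebraMap_eq_smul_one]
        simp only [mul_smul_comm, mul_one, smul_mul_assoc]
        rw [← Complex.coe_smul]; simp
  refine (h.re_mono h1).trans_eq ?_
  rw [map_smul, smul_eq_mul, ← Complex.ofReal_pow, Complex.re_ofReal_mul]

theorem norm_map_mul_le' (x y : A) : ‖ι (x * y)‖ ≤ ‖ι x‖ * ‖y‖ := by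
  rw [← h.norm_map_star, star_mul, mul_comm, ← h.norm_map_star x, ← norm_star y]
  exact h.norm_map_mul_le _ _

theorem continuous_mul_left (a : A) {x : ℕ → A} {y : A}
    (hx : Tendsto (fun n => ι (x n)) atTop (𝓝 (ι y))) :
    Tendsto (fun n => ι (a * x n)) atTop (𝓝 (ι (a * y))) := by
  rw [tendsto_iff_norm_sub_tendsto_zero] at hx ⊢
  refine squeeze_zero (fun _ => norm_nonneg _) (fun n => ?_) (by simpa using hx.const_mul ‖a‖)
  rw [← map_sub, ← map_sub, ← mul_sub]
  exact h.norm_map_mul_le _ _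

theorem continuous_mul_right (a : A) {x : ℕ → A} {y : A}
    (hx : Tendsto (fun n => ι (x n)) atTop (𝓝 (ι y))) :
    Tendsto (fun n => ι (x n * a)) atTop (𝓝 (ι (y * a))) := by
  rw [tendsto_iff_norm_sub_tendsto_zero] at hx ⊢
  refine squeeze_zero (fun _ => norm_nonneg _) (fun n => ?_) (by simpa using hx.mul_const ‖a‖)
  rw [← map_sub, ← map_sub, ← sub_mul]
  exact h.norm_map_mul_le' _ _

theorem isBoundedLimit_mul {x y : ℕ → A} {a b : A} (hx : IsBoundedLimit ι x a)
    (hy : IsBoundedLimit ι y b) : IsBoundedLimit ι (fun n => x n * y n) (a * b) := by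
  obtain ⟨⟨C, hC⟩, hx⟩ := hx
  obtain ⟨⟨C', hC'⟩, hy⟩ := hy
  refine ⟨⟨C * C', fun n => (norm_mul_le _ _).trans (mul_le_mul (hC n) (hC' n) (norm_nonneg _)
    ((norm_nonneg _).trans (hC n)))⟩, ?_⟩
  have h1 := h.continuous_mul_right b hx
  rw [tendsto_iff_norm_sub_tendsto_zero] at hy h1 ⊢
  refine squeeze_zero (fun _ => norm_nonneg _) (fun n => ?_)
    (by simpa using (hy.const_mul C).add h1)
  calc ‖ι (x n * y n) - ι (a * b)‖ = ‖ι (x n * (y n - b)) + (ι (x n * b) - ι (a * b))‖ := by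
        congr 1; rw [mul_sub, map_sub]; abel
    _ ≤ ‖ι (x n * (y n - b))‖ + ‖ι (x n * b) - ι (a * b)‖ := norm_add_le _ _
    _ ≤ C * ‖ι (y n) - ι b‖ + ‖ι (x n * b) - ι (a * b)‖ := by
        gcongr
        rw [← map_sub]
        exact (h.norm_map_mul_le _ _).trans (by gcongr; exact hC n)

theorem isBoundedLimit_star {x : ℕ → A} {a : A} (hx : IsBoundedLimit ι x a) :
    IsBoundedLimit ι (fun n => star (x n)) (star a) := by
  refine ⟨by simpa using hx.1, ?_⟩
  have h1 := hx.2
  rw [tendsto_iff_norm_sub_tendsto_zero] at h1 ⊢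
  refine h1.congr fun n => ?_
  rw [← map_sub, ← map_sub, ← star_sub, h.norm_map_star]

theorem isBoundedLimit_unique {x : ℕ → A} {a b : A} (hx : IsBoundedLimit ι x a)
    (hy : IsBoundedLimit ι x b) : a = b := by
  have := tendsto_nhds_unique hx.2 hy.2
  exact sub_eq_zero.mp (h.injective _ (by rw [map_sub, this, sub_self]))

theorem tendsto_trace {x : ℕ → A} {a : A} (hx : Tendsto (fun n => ι (x n)) atTop (𝓝 (ι a))) :
    Tendsto (fun n => τ (x n)) atTop (𝓝 (τ a)) := by
  simp only [h.apply_eq_inner]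
  exact tendsto_const_nhds.inner hx

end IsCompleteTrace

theorem isBoundedLimit_const (ι : A →ₗ[ℂ] E) (a : A) : IsBoundedLimit ι (fun _ => a) a :=
  ⟨⟨‖a‖, fun _ => le_rfl⟩, tendsto_const_nhds⟩

theorem IsBoundedLimit.add {ι : A →ₗ[ℂ] E} {x y : ℕ → A} {a b : A} (hx : IsBoundedLimit ι x a)
    (hy : IsBoundedLimit ι y b) : IsBoundedLimit ι (fun n => x n + y n) (a + b) := by
  obtain ⟨⟨C, hC⟩, hx⟩ := hx
  obtain ⟨⟨C', hC'⟩, hy⟩ := hy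
  refine ⟨⟨C + C', fun n => (norm_add_le _ _).trans (add_le_add (hC n) (hC' n))⟩, ?_⟩
  simpa using hx.add hy

theorem IsBoundedLimit.smul {ι : A →ₗ[ℂ] E} {x : ℕ → A} {a : A} (c : ℂ)
    (hx : IsBoundedLimit ι x a) : IsBoundedLimit ι (fun n => c • x n) (c • a) := by
  obtain ⟨⟨C, hC⟩, hx⟩ := hx
  refine ⟨⟨‖c‖ * C, fun n => ?_⟩, by simpa using hx.const_smul c⟩
  rw [norm_smul]; gcongr; exact hC n

theorem IsBoundedLimit.sub {ι : A →ₗ[ℂ] E} {x y : ℕ → A} {a b : A} (hx : IsBoundedLimit ι x a)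
    (hy : IsBoundedLimit ι y b) : IsBoundedLimit ι (fun n => x n - y n) (a - b) := by
  simpa [sub_eq_add_neg] using hx.add (hy.smul (-1))

theorem IsBoundedLimit.comp {ι : A →ₗ[ℂ] E} {x : ℕ → A} {a : A} (hx : IsBoundedLimit ι x a)
    {k : ℕ → ℕ} (hk : Tendsto k atTop atTop) : IsBoundedLimit ι (fun n => x (k n)) a :=
  ⟨⟨hx.1.choose, fun _ => hx.1.choose_spec _⟩, hx.2.comp hk⟩

end CompleteTrace

/-! ### Polar parts -/

section Polar

open Filter Topology Polynomial

variable {A : Type*} [CStarAlgebra A]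

theorem aeval_nonneg_of_nonneg_on_Icc [PartialOrder A] [StarOrderedRing A] {a : A} (ha : 0 ≤ a)
    (ha1 : ‖a‖ ≤ 1) (p : ℝ[X]) (hp : ∀ t ∈ Set.Icc (0 : ℝ) 1, 0 ≤ p.eval t) :
    0 ≤ aeval a p := by
  rw [← cfc_polynomial p a ha.isSelfAdjoint]
  refine cfc_nonneg fun t ht => hp t ⟨spectrum_nonneg_of_nonneg ha ht, ?_⟩
  have h1 : Nontrivial A := by
    by_contra hn
    rw [not_nontrivial_iff_subsingleton] at hn
    simp at ht
  exact (le_abs_self t).trans ((spectrum.norm_le_norm_of_mem ht).trans ha1)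

theorem star_aeval_of_isSelfAdjoint {a : A} (ha : IsSelfAdjoint a) (p : ℝ[X]) :
    star (aeval a p) = aeval a p := by
  induction p using Polynomial.induction_on' with
  | add p q hp hq => simp [hp, hq]
  | monomial n r =>
    simp [aeval_monomial, Algebra.algebraMap_eq_smul_one, ha.star_eq]

/-- The polynomials of the Newton–Schulz iteration for the polar part: if
`xₙ₊₁ = xₙ (3 - xₙ* xₙ) / 2` and `x₀ = x` then `xₙ = x qₙ(x* x)`. -/
def newtonPoly : ℕ → ℝ[X]
  | 0 => 1
  | n + 1 => C (1 / 2) * newtonPoly n * (3 - X * newtonPoly n ^ 2)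

theorem newtonPoly_eval_succ (n : ℕ) (t : ℝ) : (newtonPoly (n + 1)).eval t
    = 1 / 2 * (newtonPoly n).eval t * (3 - t * (newtonPoly n).eval t ^ 2) := by
  simp [newtonPoly]

theorem newtonPoly_bounds (n : ℕ) {t : ℝ} (ht : t ∈ Set.Icc (0 : ℝ) 1) :
    1 ≤ (newtonPoly n).eval t ∧ t * (newtonPoly n).eval t ^ 2 ≤ 1 := by
  induction n with
  | zero => simpa [newtonPoly] using ht.2
  | succ n ih =>
    rw [newtonPoly_eval_succ]
    set q := (newtonPoly n).eval t
    obtain ⟨h1, h2⟩ := ih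
    have h0 : 0 ≤ t * q ^ 2 := mul_nonneg ht.1 (sq_nonneg q)
    refine ⟨by nlinarith, ?_⟩
    set s := t * q ^ 2
    have : t * (1 / 2 * q * (3 - s)) ^ 2 = 1 - (1 - s) ^ 2 * (4 - s) / 4 := by
      have : t * (1 / 2 * q * (3 - s)) ^ 2 = s * (3 - s) ^ 2 / 4 := by simp only [s]; ring
      rw [this]; ring
    rw [this]
    have : 0 ≤ (1 - s) ^ 2 * (4 - s) := mul_nonneg (sq_nonneg _) (by linarith)
    linarith

theorem newtonPoly_monotone {t : ℝ} (ht : t ∈ Set.Icc (0 : ℝ) 1) :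
    Monotone fun n => (newtonPoly n).eval t := by
  refine monotone_nat_of_le_succ fun n => ?_
  obtain ⟨h1, h2⟩ := newtonPoly_bounds n ht
  rw [newtonPoly_eval_succ]
  nlinarith

variable {E : Type*} [NormedAddCommGroup E] [InnerProductSpace ℂ E] [CompleteSpace E]
  {τ : A →ₗ[ℂ] ℂ} {ι : A →ₗ[ℂ] E}

/-- The polar part of a contraction `x`: the Newton–Schulz iterates of `x` converge in the
`2`-norm to a partial isometry `u` with `x u* u = x`. -/
theorem IsCompleteTrace.exists_polar (h : IsCompleteTrace τ ι) {x : A} (hx : ‖x‖ ≤ 1) :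
    ∃ u, u * star u * u = u ∧ x * (1 - star u * u) = 0 ∧
      IsBoundedLimit ι (fun n => x * aeval (star x * x) (newtonPoly n)) u := by
  let _ : PartialOrder A := CStarAlgebra.spectralOrder A
  have _ : StarOrderedRing A := CStarAlgebra.spectralOrderedRing A
  set a := star x * x with ha_def
  have ha0 : 0 ≤ a := star_mul_self_nonneg x
  have ha1 : ‖a‖ ≤ 1 := by
    rw [ha_def, CStarRing.norm_star_mul_self]
    exact mul_le_one₀ hx (norm_nonneg _) hx
  have hsa : IsSelfAdjoint a := ha0.isSelfAdjoint
  set y : ℕ → A := fun n => x * aeval a (newtonPoly n) with hy_def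
  have hmul (p q : ℝ[X]) : star (x * aeval a p) * (x * aeval a q) = aeval a (X * p * q) := by
    rw [star_mul, star_aeval_of_isSelfAdjoint hsa, mul_comm X p]
    simp [mul_assoc, ha_def]
  have hpos := fun p hp => aeval_nonneg_of_nonneg_on_Icc ha0 ha1 p hp
  have hnorm (n : ℕ) : ‖y n‖ ≤ 1 := by
    have h1 : star (y n) * y n ≤ 1 := by
      rw [hmul, ← sub_nonneg]
      have := hpos (1 - X * newtonPoly n * newtonPoly n) fun t ht => by
        have := (newtonPoly_bounds n ht).2
        simp; linarith
      simpa using this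
    have h2 : ‖star (y n) * y n‖ ≤ 1 :=
      (CStarAlgebra.norm_le_one_iff_of_nonneg _ (star_mul_self_nonneg _)).mpr h1
    rw [CStarRing.norm_star_mul_self] at h2
    nlinarith [norm_nonneg (y n)]
  -- `‖yₙ - yₘ‖₂² ≤ ‖yₙ‖₂² - ‖yₘ‖₂²` for `m ≤ n`, since `(qₙ - qₘ)² ≤ qₙ² - qₘ²`
  have hstep (m n : ℕ) (hmn : m ≤ n) : ‖ι (y n) - ι (y m)‖ ^ 2 ≤ ‖ι (y n)‖ ^ 2 - ‖ι (y m)‖ ^ 2 := by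
    rw [← map_sub, h.norm_map_sq, h.norm_map_sq, h.norm_map_sq, ← Complex.sub_re, ← map_sub]
    apply h.re_mono
    have e : y n - y m = x * aeval a (newtonPoly n - newtonPoly m) := by
      simp [hy_def, mul_sub]
    rw [e, hmul, hmul, hmul, ← map_sub, ← sub_nonneg, ← map_sub]
    refine hpos _ fun t ht => ?_
    have h1 := newtonPoly_monotone ht hmn
    have h2 := (newtonPoly_bounds m ht).1
    simp only at h1
    simp only [eval_sub, eval_mul, eval_X]
    have : 0 ≤ t * ((newtonPoly n).eval t - (newtonPoly m).eval t) * (newtonPoly m).eval t :=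
      mul_nonneg (mul_nonneg ht.1 (by linarith)) (by linarith)
    linarith
  have hmono : Monotone fun n => ‖ι (y n)‖ ^ 2 := fun m n hmn => by
    have := hstep m n hmn
    have := sq_nonneg ‖ι (y n) - ι (y m)‖
    simp only; linarith
  have hbdd : BddAbove (Set.range fun n => ‖ι (y n)‖ ^ 2) := by
    refine ⟨‖ι 1‖ ^ 2, ?_⟩
    rintro _ ⟨n, rfl⟩
    have := h.norm_map_mul_le (y n) 1
    rw [mul_one] at this
    have h2 : ‖y n‖ * ‖ι 1‖ ≤ 1 * ‖ι 1‖ := by gcongr; exact hnorm n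
    simp only
    gcongr; linarith
  have hcauchy : CauchySeq fun n => ι (y n) := by
    have hc := (tendsto_atTop_ciSup hmono hbdd).cauchySeq
    rw [Metric.cauchySeq_iff'] at hc ⊢
    intro ε hε
    obtain ⟨N, hN⟩ := hc (ε ^ 2) (by positivity)
    refine ⟨N, fun n hn => ?_⟩
    have h1 := hN n hn
    rw [Real.dist_eq] at h1
    rw [dist_eq_norm]
    have := (hstep N n hn).trans_lt ((le_abs_self _).trans_lt h1)
    exact lt_of_pow_lt_pow_left₀ 2 hε.le this
  obtain ⟨ζ, hζ⟩ := cauchySeq_tendsto_of_complete hcauchy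
  obtain ⟨u, rfl⟩ := h.complete 1 y ζ hnorm hζ
  have hlim : IsBoundedLimit ι y u := ⟨⟨1, hnorm⟩, hζ⟩
  have hlim2 := h.isBoundedLimit_mul (h.isBoundedLimit_star hlim) hlim
  have hfix : u * star u * u = u := by
    have h1 : IsBoundedLimit ι (fun n => y (n + 1)) u := hlim.comp (tendsto_add_atTop_nat 1)
    have h2 : IsBoundedLimit ι (fun n => (1 / 2 : ℂ) • ((3 : ℂ) • y n - y n * (star (y n) * y n)))
        ((1 / 2 : ℂ) • ((3 : ℂ) • u - u * (star u * u))) :=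
      ((hlim.smul 3).sub (h.isBoundedLimit_mul hlim hlim2)).smul _
    have h3 : (fun n => (1 / 2 : ℂ) • ((3 : ℂ) • y n - y n * (star (y n) * y n)))
        = fun n => y (n + 1) := by
      funext n
      have e3 : (3 : ℂ) • y n = x * aeval a (3 * newtonPoly n) := by
        rw [map_mul, map_ofNat, ← Nat.cast_ofNat (R := ℂ), Nat.cast_smul_eq_nsmul, nsmul_eq_mul,
          Nat.cast_ofNat, ← mul_assoc, ← mul_assoc, (Commute.ofNat_right x 3).eq, mul_assoc]
      have e4 : (1 / 2 : ℂ) = ((1 / 2 : ℝ) : ℂ) := by push_cast; rfl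
      rw [hmul, e3, hy_def]
      simp only
      rw [mul_assoc, ← map_mul, ← mul_sub, ← map_sub, e4, Complex.coe_smul, ← mul_smul_comm,
        ← map_smul]
      congr 2
      rw [newtonPoly, smul_eq_C_mul]
      ring
    rw [h3] at h2
    have h4 := h.isBoundedLimit_unique h1 h2
    have h5 : (2 : ℂ) • u = (3 : ℂ) • u - u * (star u * u) := by
      conv_lhs => rw [h4]
      rw [smul_smul]; norm_num
    have h6 : u * (star u * u) = (3 : ℂ) • u - (2 : ℂ) • u := by rw [h5]; abel
    rw [mul_assoc, h6, ← sub_smul]; norm_num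
  refine ⟨u, hfix, ?_, hlim⟩
  have hp : (star u * u) * (star u * u) = star u * u := by
    rw [mul_assoc, ← mul_assoc u, hfix]
  apply h.injective
  have hsup := h.isBoundedLimit_mul (h.isBoundedLimit_mul
    (isBoundedLimit_const ι (1 - star u * u)) hlim2) (isBoundedLimit_const ι (1 - star u * u))
  have h0 : (1 - star u * u) * (star u * u) * (1 - star u * u) = 0 := by
    rw [sub_mul, hp, one_mul, sub_self, zero_mul]
  rw [h0] at hsup
  have ht := h.tendsto_trace hsup.2
  rw [map_zero] at ht
  have ht := Complex.continuous_re.tendsto _ |>.comp ht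
  have hle : ‖ι (x * (1 - star u * u))‖ ^ 2 ≤ 0 := by
    refine ge_of_tendsto ht (Eventually.of_forall fun n => ?_)
    rw [h.norm_map_sq]
    apply h.re_mono
    have hle : a ≤ star (y n) * y n := by
      rw [hmul, ← sub_nonneg]
      have := hpos (X * newtonPoly n * newtonPoly n - X) fun t ht => by
        have h1 := (newtonPoly_bounds n ht).1
        have := ht.1
        simp only [eval_sub, eval_mul, eval_X]
        nlinarith [mul_nonneg this (by nlinarith : 0 ≤ (newtonPoly n).eval t ^ 2 - 1)]
      simpa using this
    have := star_left_conjugate_le_conjugate hle (1 - star u * u)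
    calc _ = star (1 - star u * u) * a * (1 - star u * u) := by simp [ha_def, mul_assoc]
      _ ≤ _ := this
      _ = _ := by simp
  have : ‖ι (x * (1 - star u * u))‖ = 0 := by nlinarith [norm_nonneg (ι (x * (1 - star u * u)))]
  simpa using this

end Polar

/-! ### Maximal partial isometries in ternary rings of operators -/

section MaximalPartialIsometry

open Filter Topology Polynomial

variable {A : Type*} [CStarAlgebra A]
  {E : Type*} [NormedAddCommGroup E] [InnerProductSpace ℂ E]

theorem norm_le_one_of_isPartialIsometry {v : A} (hv : v * star v * v = v) : ‖v‖ ≤ 1 := by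
  have h1 : star (star v * v) * (star v * v) = star v * v := by
    rw [star_mul, star_star, mul_assoc, ← mul_assoc v, hv]
  have h2 := CStarRing.norm_star_mul_self (x := star v * v)
  rw [h1, CStarRing.norm_star_mul_self] at h2
  by_contra hc
  push Not at hc
  have h3 : 1 < ‖v‖ * ‖v‖ := one_lt_mul_of_lt_of_le hc hc.le
  nlinarith

/-- A subspace `X` of `A` is a closed ternary ring of operators: `X X* X ⊆ X`, and `X` contains the
`2`-norm limits of its norm-bounded sequences. -/
structure IsClosedTRO (ι : A →ₗ[ℂ] E) (X : Submodule ℂ A) : Prop where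
  mul_star_mul_mem : ∀ x ∈ X, ∀ y ∈ X, ∀ z ∈ X, x * star y * z ∈ X
  mem_of_isBoundedLimit : ∀ (x : ℕ → A) (y : A), (∀ n, x n ∈ X) → IsBoundedLimit ι x y → y ∈ X

theorem IsClosedTRO.mul_aeval_mem {ι : A →ₗ[ℂ] E} {X : Submodule ℂ A} (hX : IsClosedTRO ι X) {x : A}
    (hx : x ∈ X) (p : ℝ[X]) : x * aeval (star x * x) p ∈ X := by
  have hpow (n : ℕ) : x * (star x * x) ^ n ∈ X := by
    induction n with
    | zero => simpa using hx
    | succ n ih =>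
      rw [pow_succ, ← mul_assoc, ← mul_assoc]
      exact hX.mul_star_mul_mem _ ih _ hx _ hx
  induction p using Polynomial.induction_on' with
  | add p q hp hq => rw [map_add, mul_add]; exact X.add_mem hp hq
  | monomial n r =>
    rw [aeval_monomial, Algebra.algebraMap_eq_smul_one, smul_mul_assoc, one_mul, mul_smul_comm,
      ← Complex.coe_smul]
    exact X.smul_mem _ (hpow n)

/-- `v` is the restriction of the partial isometry `w` to its initial space; then the initial
projection of `v` is below that of `w`. -/
theorem initial_mul_initial_of_restriction {v w : A} (hv : v * star v * v = v)
    (hw : w * star w * w = w) (hvw : w * star v * v = v) :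
    star w * w * (star v * v) = star v * v := by
  set p := star v * v
  set p' := star w * w with hp'_def
  have hp : p * p = p := by simp only [p]; rw [mul_assoc, ← mul_assoc v, hv]
  have hp' : p' * p' = p' := by simp only [p']; rw [mul_assoc, ← mul_assoc w, hw]
  have hps : star p = p := by simp [p]
  have hps' : star p' = p' := by simp [p']
  have h1 : p * p' * p = p := by
    have h2 : w * p = v := by simp only [p]; rw [← mul_assoc, hvw]
    calc p * p' * p = star (w * p) * (w * p) := by
          rw [star_mul, hps, hp'_def]; simp only [mul_assoc]
      _ = p := by rw [h2]
  have h2 : (1 - p') * p = 0 := by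
    rw [← CStarRing.star_mul_self_eq_zero_iff, star_mul, star_sub, star_one, hps, hps']
    have : (1 - p') * (1 - p') = 1 - p' := by
      rw [sub_mul, mul_sub, mul_sub, hp', one_mul, mul_one, one_mul, sub_self, sub_zero]
    rw [mul_assoc, ← mul_assoc (1 - p'), this, sub_mul, mul_sub, one_mul, hp, ← mul_assoc, h1,
      sub_self]
  rw [sub_mul, one_mul, sub_eq_zero] at h2
  exact h2.symm

variable {τ : A →ₗ[ℂ] ℂ} {ι : A →ₗ[ℂ] E}

theorem IsCompleteTrace.norm_sub_sq_of_restriction (h : IsCompleteTrace τ ι) {v w : A}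
    (hv : v * star v * v = v) (hw : w * star w * w = w) (hvw : w * star v * v = v) :
    ‖ι w - ι v‖ ^ 2 = ‖ι w‖ ^ 2 - ‖ι v‖ ^ 2 := by
  have h1 : star w * v = star v * v := by
    rw [← initial_mul_initial_of_restriction hv hw hvw, mul_assoc, ← mul_assoc w, hvw]
  have h2 : star v * w = star v * v := by
    simpa using congrArg star h1
  rw [← map_sub, h.norm_map_sq, h.norm_map_sq, h.norm_map_sq, star_sub, sub_mul, mul_sub, mul_sub,
    h1, h2, sub_self, sub_zero, map_sub, Complex.sub_re]

variable [CompleteSpace E]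

/-- A closed ternary ring of operators `X` contains a partial isometry `v` such that
`(1 - v v*) X (1 - v* v) = 0`: a maximal one, which exists by Zorn's lemma since chains converge in
the `2`-norm. -/
theorem IsCompleteTrace.exists_maximal_partialIsometry (h : IsCompleteTrace τ ι)
    {X : Submodule ℂ A} (hX : IsClosedTRO ι X) :
    ∃ v ∈ X, v * star v * v = v ∧ ∀ x ∈ X, (1 - v * star v) * x * (1 - star v * v) = 0 := by
  let S := {v : A // v ∈ X ∧ v * star v * v = v}
  obtain ⟨⟨v, hvX, hv⟩, hmax⟩ : ∃ m : S, ∀ a : S, (a.1 * star m.1 * m.1 = m.1) →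
      m.1 * star a.1 * a.1 = a.1 := by
    refine exists_maximal_of_chains_bounded (r := fun v w : S => w.1 * star v.1 * v.1 = v.1)
      (fun c hc => ?_) (fun {a b d} hab hbd => ?_)
    · rcases c.eq_empty_or_nonempty with rfl | hne
      · exact ⟨⟨0, X.zero_mem, by simp⟩, by simp⟩
      set F : S → ℝ := fun v => ‖ι v.1‖ ^ 2 with hF
      have hbdd : BddAbove (F '' c) := by
        refine ⟨‖ι 1‖ ^ 2, ?_⟩
        rintro _ ⟨w, -, rfl⟩
        have h1 := h.norm_map_mul_le w.1 1
        rw [mul_one] at h1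
        have h2 : ‖w.1‖ * ‖ι 1‖ ≤ 1 * ‖ι 1‖ := by
          gcongr; exact norm_le_one_of_isPartialIsometry w.2.2
        simp only [hF]
        gcongr; linarith
      have hle (w : S) (hw : w ∈ c) : F w ≤ sSup (F '' c) := le_csSup hbdd ⟨w, hw, rfl⟩
      have hex (n : ℕ) : ∃ w ∈ c, sSup (F '' c) - 1 / ((n : ℝ) + 1) < F w := by
        obtain ⟨_, ⟨w, hw, rfl⟩, hlt⟩ := exists_lt_of_lt_csSup (hne.image F)
          (sub_lt_self (sSup (F '' c)) (Nat.one_div_pos_of_nat (α := ℝ) (n := n)))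
        exact ⟨w, hw, hlt⟩
      choose s hsc hs using hex
      have hdist (v w : S) (hvc : v ∈ c) (hwc : w ∈ c) (r : ℝ) (h1 : sSup (F '' c) - r < F v)
          (h2 : sSup (F '' c) - r < F w) : ‖ι w.1 - ι v.1‖ ^ 2 ≤ r := by
        have h3 := hle v hvc
        have h4 := hle w hwc
        rcases eq_or_ne v w with rfl | hne
        · simp; linarith
        rcases hc hvc hwc hne with h5 | h5
        · rw [h.norm_sub_sq_of_restriction v.2.2 w.2.2 h5]
          simp only [hF] at *; linarith
        · rw [norm_sub_rev, h.norm_sub_sq_of_restriction w.2.2 v.2.2 h5]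
          simp only [hF] at *; linarith
      have hcauchy : CauchySeq fun n => ι (s n).1 := by
        rw [Metric.cauchySeq_iff']
        intro ε hε
        obtain ⟨N, hN⟩ := exists_nat_one_div_lt (show 0 < ε ^ 2 by positivity)
        refine ⟨N, fun n hn => ?_⟩
        rw [dist_eq_norm]
        have h1 : 1 / ((n : ℝ) + 1) ≤ 1 / ((N : ℝ) + 1) := Nat.one_div_le_one_div hn
        refine lt_of_pow_lt_pow_left₀ 2 hε.le ((hdist _ _ (hsc N) (hsc n) _ (hs N) ?_).trans_lt hN)
        have := hs n
        linarith
      obtain ⟨ζ, hζ⟩ := cauchySeq_tendsto_of_complete hcauchy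
      have hbd (n : ℕ) : ‖(s n).1‖ ≤ 1 := norm_le_one_of_isPartialIsometry (s n).2.2
      obtain ⟨u, rfl⟩ := h.complete 1 _ ζ hbd hζ
      have hlim : IsBoundedLimit ι (fun n => (s n).1) u := ⟨⟨1, hbd⟩, hζ⟩
      have hu : u * star u * u = u := by
        have := h.isBoundedLimit_mul (h.isBoundedLimit_mul hlim (h.isBoundedLimit_star hlim)) hlim
        simp only [(s _).2.2] at this
        exact h.isBoundedLimit_unique this hlim
      refine ⟨⟨u, hX.mem_of_isBoundedLimit _ _ (fun n => (s n).2.1) hlim, hu⟩, fun w hw => ?_⟩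
      have hlim2 : Tendsto (fun n => ι ((s n).1 * (star w.1 * w.1)))
          atTop (𝓝 (ι (u * (star w.1 * w.1)))) := h.continuous_mul_right _ hζ
      have hlim3 : Tendsto (fun n => ι ((s n).1 * (star w.1 * w.1))) atTop (𝓝 (ι w.1)) := by
        rw [tendsto_iff_norm_sub_tendsto_zero]
        have h0 : Tendsto (fun n : ℕ => Real.sqrt (1 / ((n : ℝ) + 1))) atTop (𝓝 0) := by
          have := tendsto_one_div_add_atTop_nhds_zero_nat (𝕜 := ℝ)
          simpa using this.sqrt
        refine squeeze_zero (fun _ => norm_nonneg _) (fun n => ?_) h0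
        apply Real.le_sqrt_of_sq_le
        have h1 : (0 : ℝ) ≤ 1 / ((n : ℝ) + 1) := by positivity
        have hrefl : w.1 * (star w.1 * w.1) = w.1 := by rw [← mul_assoc, w.2.2]
        have hcase : (s n).1 * (star w.1 * w.1) = w.1 ∨ w.1 * star (s n).1 * (s n).1 = (s n).1 := by
          rcases eq_or_ne (s n) w with h2 | hne
          · left; rw [h2, hrefl]
          · rcases hc (hsc n) hw hne with h5 | h5
            · exact Or.inr h5
            · left; rw [← mul_assoc]; exact h5
        rcases hcase with h2 | h2
        · simpa [h2] using h1
        · have h3 : ‖ι ((s n).1 * (star w.1 * w.1)) - ι w.1‖ ≤ ‖ι w.1 - ι (s n).1‖ := by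
            have e : ι ((s n).1 * (star w.1 * w.1)) - ι w.1
                = ι (((s n).1 - w.1) * (star w.1 * w.1)) := by
              rw [sub_mul, hrefl, map_sub]
            rw [e]
            refine (h.norm_map_mul_le' _ _).trans ?_
            have h4 : ‖star w.1 * w.1‖ ≤ 1 := by
              rw [CStarRing.norm_star_mul_self]
              have := norm_le_one_of_isPartialIsometry w.2.2
              exact mul_le_one₀ this (norm_nonneg _) this
            rw [map_sub, norm_sub_rev]
            exact mul_le_of_le_one_right (norm_nonneg _) h4
          refine (pow_le_pow_left₀ (norm_nonneg _) h3 2).trans ?_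
          rw [h.norm_sub_sq_of_restriction (s n).2.2 w.2.2 h2]
          have h5 := hs n
          have h6 := hle w hw
          simp only [hF] at h5 h6
          linarith
      have := tendsto_nhds_unique hlim2 hlim3
      change u * star w.1 * w.1 = w.1
      rw [mul_assoc]
      exact sub_eq_zero.mp (h.injective _ (by rw [map_sub, this, sub_self]))
    · have h1 := initial_mul_initial_of_restriction a.2.2 b.2.2 hab
      calc d.1 * star a.1 * a.1 = d.1 * (star b.1 * b.1 * (star a.1 * a.1)) := by
            rw [h1, mul_assoc]
        _ = (d.1 * star b.1 * b.1) * star a.1 * a.1 := by simp only [mul_assoc]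
        _ = a.1 := by rw [hbd, hab]
  refine ⟨v, hvX, hv, fun x hx => ?_⟩
  have hv' : star v * v * star v = star v := by simpa [mul_assoc] using congrArg star hv
  -- the polar part of an element of `X` which is orthogonal to `v` extends `v`
  let Y : Submodule ℂ A :=
    { carrier := {z | z ∈ X ∧ star v * z = 0 ∧ z * star v = 0}
      add_mem' := fun {a b} ha hb => ⟨X.add_mem ha.1 hb.1,
        by rw [mul_add, ha.2.1, hb.2.1, add_zero],
        by rw [add_mul, ha.2.2, hb.2.2, add_zero]⟩
      zero_mem' := ⟨X.zero_mem, mul_zero _, zero_mul _⟩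
      smul_mem' := fun c a ha => ⟨X.smul_mem c ha.1, by rw [mul_smul_comm, ha.2.1, smul_zero],
        by rw [smul_mul_assoc, ha.2.2, smul_zero]⟩ }
  have hY : IsClosedTRO ι Y := by
    constructor
    · rintro a ⟨ha, ha1, -⟩ b ⟨hb, -, -⟩ d ⟨hd, -, hd2⟩
      refine ⟨hX.mul_star_mul_mem a ha b hb d hd, ?_, ?_⟩
      · rw [← mul_assoc, ← mul_assoc, ha1, zero_mul, zero_mul]
      · rw [mul_assoc, hd2, mul_zero]
    · intro a b ha hab
      have hc := isBoundedLimit_const ι (star v)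
      have h0 := isBoundedLimit_const ι (0 : A)
      refine ⟨hX.mem_of_isBoundedLimit a b (fun n => (ha n).1) hab, ?_, ?_⟩
      · have h1 := h.isBoundedLimit_mul hc hab
        simp only [(ha _).2.1] at h1
        exact h.isBoundedLimit_unique h1 h0
      · have h1 := h.isBoundedLimit_mul hab hc
        simp only [(ha _).2.2] at h1
        exact h.isBoundedLimit_unique h1 h0
  set y := (1 - v * star v) * x * (1 - star v * v) with hy_def
  have hyY : y ∈ Y := by
    refine ⟨?_, ?_, ?_⟩
    · have : y = x - v * star v * x - x * star v * v + v * star v * (x * star v * v) := by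
        rw [hy_def]; noncomm_ring
      rw [this]
      have h1 := hX.mul_star_mul_mem x hx v hvX v hvX
      exact X.add_mem (X.sub_mem (X.sub_mem hx (hX.mul_star_mul_mem _ hvX _ hvX _ hx)) h1)
        (hX.mul_star_mul_mem _ hvX _ hvX _ h1)
    · have h1 : star v * (1 - v * star v) = 0 := by
        rw [mul_sub, mul_one, ← mul_assoc, hv', sub_self]
      rw [hy_def, ← mul_assoc, ← mul_assoc, h1, zero_mul, zero_mul]
    · have h1 : (1 - star v * v) * star v = 0 := by rw [sub_mul, one_mul, hv', sub_self]
      rw [hy_def, mul_assoc, h1, mul_zero]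
  by_contra hy0
  set y' := ((‖y‖⁻¹ : ℝ) : ℂ) • y with hy'_def
  have hy'Y : y' ∈ Y := Y.smul_mem _ hyY
  have hy'1 : ‖y'‖ ≤ 1 := by
    rw [hy'_def, norm_smul, Complex.norm_real, norm_inv, norm_norm]
    exact inv_mul_le_one
  obtain ⟨u, hu, hyu, hlim⟩ := h.exists_polar hy'1
  obtain ⟨huX, hu1, hu2⟩ : u ∈ Y :=
    hY.mem_of_isBoundedLimit _ _ (fun n => hY.mul_aeval_mem hy'Y _) hlim
  have hu3 : v * star u = 0 := by simpa using congrArg star hu2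
  have h1 : (v + u) * star (v + u) * (v + u) = v + u := by
    have h2 : star u * v = 0 := by simpa using congrArg star hu1
    have h3 : (v + u) * star (v + u) = v * star v + u * star u := by
      rw [star_add, add_mul, mul_add, mul_add, hu2, hu3, add_zero, zero_add]
    rw [h3, add_mul, mul_add, mul_add, hv, hu, mul_assoc v, hu1, mul_assoc u, h2, mul_zero,
      mul_zero, add_zero, zero_add]
  have h2 := hmax ⟨v + u, X.add_mem hvX huX, h1⟩ (by
    simp only
    rw [add_mul, add_mul, hu2, hv, zero_mul, add_zero])
  simp only at h2
  have h3 : v * star (v + u) = v * star v := by rw [star_add, mul_add, hu3, add_zero]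
  rw [h3, mul_add, hv, mul_assoc, hu1, mul_zero, add_zero] at h2
  have hu0 : u = 0 := by simpa using h2
  rw [hu0] at hyu
  have : y' = 0 := by simpa using hyu
  rw [hy'_def, smul_eq_zero] at this
  rcases this with h3 | h3
  · rw [Complex.ofReal_eq_zero, inv_eq_zero, norm_eq_zero] at h3
    exact hy0 h3
  · exact hy0 h3

end MaximalPartialIsometry

/-! ### Gradings and averaging -/

section Grading

open Filter Topology

variable {G : Type*} [Group G] [Fintype G] [DecidableEq G] {A : Type*} [CStarAlgebra A]

/-- The maps `δ g` are the projections of a `*`-algebra `A` onto the homogeneous components of a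
`G`-grading of `A`. -/
structure IsGrading (δ : G → A →ₗ[ℂ] A) : Prop where
  sum_apply : ∀ x, ∑ g, δ g x = x
  apply_apply : ∀ g h x, δ g (δ h x) = if g = h then δ h x else 0
  map_mul : ∀ l x y, δ l (x * y) = ∑ g, δ g x * δ (g⁻¹ * l) y
  map_star : ∀ g x, δ g (star x) = star (δ g⁻¹ x)
  map_one : ∀ g, δ g 1 = if g = 1 then 1 else 0

/-- The representation of `A` on `A ⊗ ℓ²(G)` given by a `G`-grading: `x` acts by the matrix with
entries `δ (k⁻¹ h) x`. -/
def gradingRep (δ : G → A →ₗ[ℂ] A) (x : A) : (G → A) →ₗ[ℂ] (G → A) where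
  toFun a k := ∑ h, δ (k⁻¹ * h) x * a h
  map_add' a b := by ext k; simp [mul_add, Finset.sum_add_distrib]
  map_smul' c a := by ext k; simp [Finset.smul_sum]

/-- A `G`-grading of `A` is free if the intertwiners between the right multiplication of `A` and its
representation on `A ⊗ ℓ²(G)` are the multiples of the constant function `1`. -/
def IsFreeGrading (δ : G → A →ₗ[ℂ] A) : Prop :=
  ∀ b : G → A, (∀ x k, gradingRep δ x b k = b k * x) → ∃ c : ℂ, ∀ h, b h = c • 1

namespace IsGrading

variable {δ : G → A →ₗ[ℂ] A} (hδ : IsGrading δ)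

include hδ

theorem gradingRep_mul (x y : A) (a : G → A) :
    gradingRep δ (x * y) a = gradingRep δ x (gradingRep δ y a) := by
  ext k
  simp only [gradingRep, LinearMap.coe_mk, AddHom.coe_mk, hδ.map_mul, Finset.sum_mul,
    Finset.mul_sum]
  rw [Finset.sum_comm]
  refine Fintype.sum_equiv (Equiv.mulLeft k) _ _ fun g => ?_
  refine Finset.sum_congr rfl fun h _ => ?_
  simp [mul_assoc]

theorem gradingRep_one (a : G → A) : gradingRep δ 1 a = a := by
  ext k
  simp [gradingRep, hδ.map_one, inv_mul_eq_one]

theorem sum_gradingRep (x : A) (a : G → A) : ∑ k, gradingRep δ x a k = x * ∑ h, a h := by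
  simp only [gradingRep, LinearMap.coe_mk, AddHom.coe_mk]
  rw [Finset.sum_comm, Finset.mul_sum]
  refine Finset.sum_congr rfl fun h _ => ?_
  rw [← Finset.sum_mul]
  congr 1
  rw [← hδ.sum_apply x]
  refine Fintype.sum_equiv ((Equiv.inv G).trans (Equiv.mulRight h)) _ _ fun g => ?_
  simp [hδ.sum_apply]

theorem sum_star_gradingRep_mul (x : A) (a b : G → A) :
    ∑ k, star (gradingRep δ x a k) * b k = ∑ h, star (a h) * gradingRep δ (star x) b h := by
  simp only [gradingRep, LinearMap.coe_mk, AddHom.coe_mk, star_sum, Finset.sum_mul, Finset.mul_sum]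
  rw [Finset.sum_comm]
  refine Finset.sum_congr rfl fun h _ => Finset.sum_congr rfl fun k _ => ?_
  rw [hδ.map_star, star_mul]
  simp [mul_assoc]

theorem map_one_star_mul_self (x : A) : δ 1 (star x * x) = ∑ g, star (δ g x) * δ g x := by
  rw [hδ.map_mul]
  refine Fintype.sum_equiv (Equiv.inv G) _ _ fun g => ?_
  simp [hδ.map_star]

theorem norm_apply_le_one {u : A} (hu : u ∈ unitary A) (g : G) : ‖δ g u‖ ≤ 1 := by
  let _ : PartialOrder A := CStarAlgebra.spectralOrder A
  have _ : StarOrderedRing A := CStarAlgebra.spectralOrderedRing A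
  have h1 : star (δ g u) * δ g u ≤ 1 := by
    have := hδ.map_one_star_mul_self u
    rw [(Unitary.mem_iff.mp hu).1, hδ.map_one, if_pos rfl] at this
    rw [this]
    exact Finset.single_le_sum (f := fun g => star (δ g u) * δ g u)
      (fun g _ => star_mul_self_nonneg _) (Finset.mem_univ g)
  have h2 := (CStarAlgebra.norm_le_one_iff_of_nonneg _ (star_mul_self_nonneg _)).mpr h1
  rw [CStarRing.norm_star_mul_self] at h2
  nlinarith [norm_nonneg (δ g u)]

end IsGrading

variable {E : Type*} [NormedAddCommGroup E] [InnerProductSpace ℂ E]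

/-- A nonempty closed convex set in a Hilbert space has a unique point of least norm. -/
theorem exists_unique_norm_minimizer {F : Type*} [NormedAddCommGroup F] [InnerProductSpace ℂ F]
    [CompleteSpace F] {L : Set F} (hconv : Convex ℝ L) (hcl : IsClosed L) (hne : L.Nonempty) :
    ∃ ζ ∈ L, (∀ η ∈ L, ‖ζ‖ ≤ ‖η‖) ∧ ∀ η ∈ L, ‖η‖ = ‖ζ‖ → η = ζ := by
  let _ : InnerProductSpace ℝ F := InnerProductSpace.rclikeToReal ℂ F
  obtain ⟨ζ, hζL, hζ⟩ := exists_norm_eq_iInf_of_complete_convex hne hcl.isComplete hconv 0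
  have hζmin (η) (hη : η ∈ L) : ‖ζ‖ ≤ ‖η‖ := by
    have : (⨅ w : L, ‖0 - (w : F)‖) ≤ ‖0 - η‖ :=
      ciInf_le ⟨0, by rintro _ ⟨w, rfl⟩; positivity⟩ (⟨η, hη⟩ : L)
    rw [← hζ] at this
    simpa using this
  refine ⟨ζ, hζL, hζmin, fun η hη hn => ?_⟩
  have h1 := hζmin _ (hconv hη hζL (by norm_num : (0 : ℝ) ≤ 1 / 2)
    (by norm_num : (0 : ℝ) ≤ 1 / 2) (by norm_num))
  rw [← smul_add, norm_smul] at h1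
  have h2 := parallelogram_law_with_norm ℂ η ζ
  rw [hn] at h2
  norm_num at h1
  have h3 : ‖η - ζ‖ = 0 := by
    have h4 : 2 * ‖ζ‖ ≤ ‖η + ζ‖ := by linarith
    have := mul_self_le_mul_self (by positivity) h4
    nlinarith [norm_nonneg (η - ζ)]
  exact sub_eq_zero.mp (norm_eq_zero.mp h3)

section Amplify

variable {G : Type*} [Fintype G]

/-- The map `ι ⊗ 1` from `A ⊗ ℓ²(G)` to the Hilbert space `E ⊗ ℓ²(G)`. -/
def amplify (G : Type*) [Fintype G] (ι : A →ₗ[ℂ] E) : (G → A) →ₗ[ℂ] PiLp 2 (fun _ : G => E) :=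
  (WithLp.linearEquiv 2 ℂ (G → E)).symm.toLinearMap ∘ₗ ι.compLeft G

theorem amplify_apply (ι : A →ₗ[ℂ] E) (a : G → A) (h : G) : amplify G ι a h = ι (a h) := rfl

end Amplify

/-- The action of a unitary `u` on `A ⊗ ℓ²(G)`, by the representation on the left and by `u*` on the
right. -/
def twistedAct (δ : G → A →ₗ[ℂ] A) (u : A) : (G → A) →ₗ[ℂ] (G → A) where
  toFun a k := gradingRep δ u a k * star u
  map_add' a b := by ext k; simp [add_mul]
  map_smul' c a := by ext k; simp

variable {τ : A →ₗ[ℂ] ℂ} {ι : A →ₗ[ℂ] E} {δ : G → A →ₗ[ℂ] A}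

theorem IsCompleteTrace.norm_map_mul_star_of_mem_unitary (hτ : IsCompleteTrace τ ι) {u : A}
    (hu : u ∈ unitary A) (x : A) : ‖ι (x * star u)‖ = ‖ι x‖ := by
  rw [← hτ.norm_map_star, ← hτ.norm_map_star x, ← sq_eq_sq₀ (norm_nonneg _) (norm_nonneg _),
    hτ.norm_map_sq, hτ.norm_map_sq]
  congr 2
  rw [star_mul, star_star, star_mul, star_star, mul_assoc, ← mul_assoc (star u),
    (Unitary.mem_iff.mp hu).1, one_mul]

theorem IsCompleteTrace.norm_amplify_twistedAct (hτ : IsCompleteTrace τ ι) (hδ : IsGrading δ)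
    {u : A}
    (hu : u ∈ unitary A) (a : G → A) :
    ‖amplify G ι (twistedAct δ u a)‖ = ‖amplify G ι a‖ := by
  rw [← sq_eq_sq₀ (norm_nonneg _) (norm_nonneg _), PiLp.norm_sq_eq_of_L2, PiLp.norm_sq_eq_of_L2]
  simp only [amplify_apply, twistedAct, LinearMap.coe_mk, AddHom.coe_mk,
    hτ.norm_map_mul_star_of_mem_unitary hu, hτ.norm_map_sq]
  rw [← Complex.re_sum, ← Complex.re_sum, ← map_sum, ← map_sum, hδ.sum_star_gradingRep_mul,
    ← hδ.gradingRep_mul, (Unitary.mem_iff.mp hu).1, hδ.gradingRep_one]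

theorem IsGrading.twistedAct_mul (hδ : IsGrading δ) (u v : A) (a : G → A) :
    twistedAct δ (u * v) a = twistedAct δ u (twistedAct δ v a) := by
  ext k
  simp only [twistedAct, LinearMap.coe_mk, AddHom.coe_mk, hδ.gradingRep_mul, star_mul]
  simp [gradingRep, Finset.sum_mul, mul_assoc]

variable [CompleteSpace E]

/-- For a free `G`-grading, a relation `p ∑ₕ δ h (x) aₕ = 0` in `x` forces `τ (∑ₕ aₕ) p = 0`. The
element of least `2`-norm in the closed convex hull of the orbit of `a` under the twisted action of
the unitaries is a fixed point, so it is a constant scalar by freeness, and both `p a₁ = 0` and the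
value of `τ (∑ₕ aₕ)` persist on that hull. -/
theorem IsCompleteTrace.smul_eq_zero_of_relation (hτ : IsCompleteTrace τ ι) (hδ : IsGrading δ)
    (hfree : IsFreeGrading δ) (p : A) (a : G → A) (hrel : ∀ x, p * ∑ h, δ h x * a h = 0) :
    τ (∑ h, a h) • p = 0 := by
  let orbit : Set (G → A) := {b | ∃ u ∈ unitary A, b = twistedAct δ u a}
  let K : Set (G → A) := convexHull ℝ orbit
  have hKmin {s : Set (G → A)} (hs : orbit ⊆ s) (hc : Convex ℝ s) : K ⊆ s := convexHull_min hs hc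
  have horbit : orbit ⊆ K := subset_convexHull ℝ orbit
  have haK : a ∈ K := horbit ⟨1, one_mem _, by
    ext k; simp [twistedAct, hδ.gradingRep_one]⟩
  have hKstable (u : A) (hu : u ∈ unitary A) : ∀ b ∈ K, twistedAct δ u b ∈ K := by
    refine hKmin (s := twistedAct δ u ⁻¹' K) ?_ ?_
    · rintro _ ⟨v, hv, rfl⟩
      exact horbit ⟨u * v, mul_mem hu hv, (hδ.twistedAct_mul u v a).symm⟩
    · exact (convex_convexHull ℝ orbit).linear_preimage ((twistedAct δ u).restrictScalars ℝ)
  have hKbdd : ∀ b ∈ K, ∀ k, ‖b k‖ ≤ ∑ h, ‖a h‖ := by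
    refine hKmin (s := {b | ∀ k, ‖b k‖ ≤ ∑ h, ‖a h‖}) ?_ ?_
    · rintro _ ⟨u, hu, rfl⟩ k
      simp only [twistedAct, gradingRep, LinearMap.coe_mk, AddHom.coe_mk]
      rw [CStarRing.norm_mul_mem_unitary _ (Unitary.star_mem hu)]
      refine (norm_sum_le _ _).trans (Finset.sum_le_sum fun h _ => (norm_mul_le _ _).trans ?_)
      exact mul_le_of_le_one_left (norm_nonneg _) (hδ.norm_apply_le_one hu _)
    · intro b hb d hd s t hs ht hst k
      calc ‖s • b k + t • d k‖ ≤ ‖s • b k‖ + ‖t • d k‖ := norm_add_le _ _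
        _ ≤ s * ∑ h, ‖a h‖ + t * ∑ h, ‖a h‖ := by
          rw [norm_smul, norm_smul, Real.norm_of_nonneg hs, Real.norm_of_nonneg ht]
          gcongr
          · exact hb k
          · exact hd k
        _ = ∑ h, ‖a h‖ := by rw [← add_mul, hst, one_mul]
  have hKp : ∀ b ∈ K, p * b 1 = 0 := by
    refine hKmin (s := {b | p * b 1 = 0}) ?_ ?_
    · rintro _ ⟨u, hu, rfl⟩
      have := hrel u
      simp only [Set.mem_ofPred_eq, twistedAct, gradingRep, LinearMap.coe_mk, AddHom.coe_mk,
        inv_one, one_mul]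
      rw [← mul_assoc, this, zero_mul]
    · intro b hb d hd s t _ _ _
      simp only [Set.mem_ofPred_eq] at hb hd ⊢
      simp [mul_add, hb, hd]
  have hKτ : ∀ b ∈ K, τ (∑ h, b h) = τ (∑ h, a h) := by
    refine hKmin (s := {b | τ (∑ h, b h) = τ (∑ h, a h)}) ?_ ?_
    · rintro _ ⟨u, hu, rfl⟩
      simp only [Set.mem_ofPred_eq, twistedAct, LinearMap.coe_mk, AddHom.coe_mk]
      rw [← Finset.sum_mul, hδ.sum_gradingRep, hτ.tracial, ← mul_assoc,
        (Unitary.mem_iff.mp hu).1, one_mul]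
    · intro b hb d hd s t _ _ hst
      simp only [Set.mem_ofPred_eq] at hb hd ⊢
      have e : ∑ h, (s • b + t • d) h = (s : ℂ) • ∑ h, b h + (t : ℂ) • ∑ h, d h := by
        simp [Finset.sum_add_distrib, Finset.smul_sum]
      rw [e, map_add, map_smul, map_smul, hb, hd, ← add_smul, ← Complex.ofReal_add, hst]
      simp
  -- a point of least norm in the closure of the hull
  set L : Set (PiLp 2 (fun _ : G => E)) := closure (amplify G ι '' K) with hL
  have hLconv : Convex ℝ L :=
    ((convex_convexHull ℝ orbit).linear_image ((amplify G ι).restrictScalars ℝ)).closure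
  obtain ⟨ζ, hζL, -, hζuniq⟩ := exists_unique_norm_minimizer hLconv isClosed_closure
    ⟨amplify G ι a, subset_closure ⟨a, haK, rfl⟩⟩
  obtain ⟨s, hs, hsζ⟩ := mem_closure_iff_seq_limit.mp hζL
  choose y hyK hys using hs
  have hcoord (k : G) : Tendsto (fun n => ι (y n k)) atTop (𝓝 (ζ k)) := by
    rw [tendsto_iff_norm_sub_tendsto_zero] at hsζ ⊢
    refine squeeze_zero (fun _ => norm_nonneg _) (fun n => ?_) hsζ
    rw [← amplify_apply, hys]
    exact PiLp.norm_apply_le (s n - ζ) k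
  choose b hb using fun k => hτ.complete _ _ _ (fun n => hKbdd _ (hyK n) k) (hcoord k)
  have hbζ : amplify G ι b = ζ := by
    ext k; rw [amplify_apply, hb]
  have hfix (u : A) (hu : u ∈ unitary A) : twistedAct δ u b = b := by
    have h1 : amplify G ι (twistedAct δ u b) ∈ L := by
      refine mem_closure_of_tendsto (f := fun n => amplify G ι (twistedAct δ u (y n)))
        (b := atTop) ?_ (Eventually.of_forall fun n => ⟨_, hKstable u hu _ (hyK n), rfl⟩)
      rw [tendsto_iff_norm_sub_tendsto_zero] at hsζ ⊢
      refine hsζ.congr fun n => ?_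
      rw [← map_sub, ← map_sub, hτ.norm_amplify_twistedAct hδ hu, map_sub, hbζ, hys]
    have h2 := hζuniq _ h1 (by rw [hτ.norm_amplify_twistedAct hδ hu, hbζ])
    rw [← hbζ] at h2
    ext k
    have h3 := congrArg (fun z => z k) h2
    simp only [amplify_apply] at h3
    exact sub_eq_zero.mp (hτ.injective _ (by rw [map_sub, h3, sub_self]))
  obtain ⟨c, hc⟩ := hfree b fun x k => by
    let Λ : A →ₗ[ℂ] A :=
      { toFun := fun x => gradingRep δ x b k - b k * x
        map_add' := fun x y => by
          simp only [gradingRep, LinearMap.coe_mk, AddHom.coe_mk, map_add, add_mul, mul_add,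
            Finset.sum_add_distrib]
          abel
        map_smul' := fun c x => by
          simp [gradingRep, Finset.smul_sum, smul_sub] }
    have hΛ : Submodule.span ℂ (unitary A : Set A) ≤ LinearMap.ker Λ := by
      rw [Submodule.span_le]
      intro u hu
      have h1 := congrFun (hfix u hu) k
      simp only [twistedAct, LinearMap.coe_mk, AddHom.coe_mk] at h1
      rw [SetLike.mem_coe, LinearMap.mem_ker]
      change gradingRep δ u b k - b k * u = 0
      rw [← h1, mul_assoc, (Unitary.mem_iff.mp hu).1, mul_one, sub_self]
    rw [CStarAlgebra.span_unitary] at hΛ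
    exact sub_eq_zero.mp (hΛ (Submodule.mem_top (x := x)))
  have hlim (k : G) : Tendsto (fun n => ι (y n k)) atTop (𝓝 (ι (b k))) := by
    rw [hb]; exact hcoord k
  have hcp : c • p = 0 := by
    have h1 := hτ.continuous_mul_left p (hlim 1)
    simp only [hKp _ (hyK _), hc] at h1
    have := tendsto_nhds_unique h1 tendsto_const_nhds
    rw [map_zero] at this
    simpa using hτ.injective _ this
  have hcτ : τ (∑ h, a h) = Fintype.card G • c := by
    have h1 : Tendsto (fun n => τ (∑ h, y n h)) atTop (𝓝 (∑ h, τ (b h))) := by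
      simp only [map_sum]
      exact tendsto_finsetSum _ fun k _ => hτ.tendsto_trace (hlim k)
    simp only [hKτ _ (hyK _)] at h1
    rw [tendsto_nhds_unique tendsto_const_nhds h1]
    simp [hc, hτ.map_one]
  rw [hcτ, smul_assoc, hcp, smul_zero]

end Grading

/-! ### Comparison of projections and automatic continuity of traces -/

section Comparison

open Filter Topology Polynomial

variable {A : Type*} [CStarAlgebra A]
  {E : Type*} [NormedAddCommGroup E] [InnerProductSpace ℂ E] [CompleteSpace E]
  {τ : A →ₗ[ℂ] ℂ} {ι : A →ₗ[ℂ] E}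

theorem Commute.aeval_right {a b : A} (h : Commute a b) (p : ℝ[X]) :
    Commute a (aeval b p) := by
  induction p using Polynomial.induction_on' with
  | add p q hp hq => rw [map_add]; exact hp.add_right hq
  | monomial n r =>
    rw [aeval_monomial]
    exact (Algebra.commute_algebraMap_right r a).mul_right (h.pow_right n)

theorem isGrading_id : IsGrading (fun _ : Unit => (LinearMap.id : A →ₗ[ℂ] A)) := by
  constructor <;> simp

/-- Factors are prime: this is the averaging lemma for the trivial group. -/
theorem IsCompleteTrace.smul_eq_zero_of_forall_mul_mul (hτ : IsCompleteTrace τ ι)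
    (hfac : ∀ x : A, (∀ y, x * y = y * x) → ∃ c : ℂ, x = c • 1) (p q : A)
    (h : ∀ x, p * (x * q) = 0) : τ q • p = 0 := by
  have hfree : IsFreeGrading (fun _ : Unit => (LinearMap.id : A →ₗ[ℂ] A)) := fun b hb => by
    obtain ⟨c, hc⟩ := hfac (b ()) fun y => by simpa [gradingRep] using (hb y ()).symm
    exact ⟨c, fun _ => hc⟩
  simpa using hτ.smul_eq_zero_of_relation isGrading_id hfree p (fun _ => q) (by simpa using h)

/-- Comparison of projections in a finite factor. -/
theorem IsCompleteTrace.exists_partialIsometry_of_le (hτ : IsCompleteTrace τ ι)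
    (hfac : ∀ x : A, (∀ y, x * y = y * x) → ∃ c : ℂ, x = c • 1) {e f : A}
    (he : IsStarProjection e) (hf : IsStarProjection f) (hle : (τ e).re ≤ (τ f).re) :
    ∃ v, star v * v = e ∧ f * v = v := by
  let _ : PartialOrder A := CStarAlgebra.spectralOrder A
  have _ : StarOrderedRing A := CStarAlgebra.spectralOrderedRing A
  have hee : e * e = e := he.isIdempotentElem
  have hff : f * f = f := hf.isIdempotentElem
  have hes : star e = e := he.isSelfAdjoint
  have hfs : star f = f := hf.isSelfAdjoint
  let X : Submodule ℂ A :=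
    { carrier := {z | f * z = z ∧ z * e = z}
      add_mem' := fun ha hb => ⟨by rw [mul_add, ha.1, hb.1], by rw [add_mul, ha.2, hb.2]⟩
      zero_mem' := ⟨mul_zero _, zero_mul _⟩
      smul_mem' := fun c a ha => ⟨by rw [mul_smul_comm, ha.1], by rw [smul_mul_assoc, ha.2]⟩ }
  have hX : IsClosedTRO ι X := by
    constructor
    · rintro x ⟨hx, -⟩ y - z ⟨-, hz⟩
      exact ⟨by rw [← mul_assoc, ← mul_assoc, hx], by rw [mul_assoc, hz]⟩
    · intro x y hx hxy
      constructor
      · have := hτ.isBoundedLimit_mul (isBoundedLimit_const ι f) hxy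
        simp only [(hx _).1] at this
        exact hτ.isBoundedLimit_unique this hxy
      · have := hτ.isBoundedLimit_mul hxy (isBoundedLimit_const ι e)
        simp only [(hx _).2] at this
        exact hτ.isBoundedLimit_unique this hxy
  obtain ⟨v, ⟨hfv, hve⟩, hv, hmax⟩ := hτ.exists_maximal_partialIsometry hX
  refine ⟨v, ?_, hfv⟩
  have hvf : star v * f = star v := by simpa [hfs] using congrArg star hfv
  have hev : e * star v = star v := by simpa [hes] using congrArg star hve
  have hrel : ∀ x, (f - v * star v) * (x * (e - star v * v)) = 0 := fun x => by
    have h1 := hmax (f * x * e)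
      ⟨by rw [← mul_assoc, ← mul_assoc, hff], by rw [mul_assoc, hee]⟩
    calc (f - v * star v) * (x * (e - star v * v))
        = (f - v * (star v * f)) * x * (e - (e * star v) * v) := by rw [hvf, hev, mul_assoc]
      _ = (1 - v * star v) * (f * x * e) * (1 - star v * v) := by
        noncomm_ring
      _ = 0 := h1
  have hpos : 0 ≤ e - star v * v := by
    have : e - star v * v = star (e - star v * v) * (e - star v * v) := by
      rw [star_sub, hes, star_mul, star_star, sub_mul, mul_sub, mul_sub, hee, ← mul_assoc, hev,
        mul_assoc (star v), hve, mul_assoc, ← mul_assoc v, hv, sub_self, sub_zero]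
    rw [this]
    exact star_mul_self_nonneg _
  have hle0 : (τ (e - star v * v)).re ≤ 0 := by
    rcases smul_eq_zero.mp (hτ.smul_eq_zero_of_forall_mul_mul hfac _ _ hrel) with h0 | h0
    · rw [h0]; simp
    · rw [map_sub, hτ.tracial, ← sub_eq_zero.mp h0]
      simpa using hle
  have := hτ.eq_zero_of_nonneg hpos (le_antisymm hle0 (hτ.re_nonneg hpos))
  exact (sub_eq_zero.mp this).symm

/-- The spectral projection `e` of a positive contraction `x` for the half-line `(ε, ∞)`, together
with `y = (x - ε)₊`: it is the support projection of `y`, and Chebyshev's inequality holds. -/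
theorem IsCompleteTrace.exists_spectralProjection [PartialOrder A] [StarOrderedRing A]
    (hτ : IsCompleteTrace τ ι) {x : A} (hx0 : 0 ≤ x) (hx1 : x ≤ 1) {ε : ℝ} (hε : 0 ≤ ε) :
    ∃ e y : A, IsStarProjection e ∧ 0 ≤ y ∧ y ≤ 1 ∧ x ≤ (ε : ℂ) • 1 + y ∧ y * e = y ∧
      ε * (τ e).re ≤ (τ x).re := by
  have hxsa : IsSelfAdjoint x := hx0.isSelfAdjoint
  set f : ℝ → ℝ := fun t => max (t - ε) 0 with hf
  have hfc : Continuous f := by fun_prop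
  set y := cfc f x with hy_def
  have hy0 : 0 ≤ y := cfc_nonneg fun t _ => le_max_right _ _
  have hxspec (t : ℝ) (ht : t ∈ spectrum ℝ x) : t ≤ 1 := (CFC.le_one_iff (R := ℝ) x).mp hx1 t ht
  have hy1 : y ≤ 1 := cfc_le_one f x fun t ht => max_le (by linarith [hxspec t ht]) zero_le_one
  have hxy : x ≤ (ε : ℂ) • 1 + y := by
    rw [Complex.coe_smul, ← Algebra.algebraMap_eq_smul_one, hy_def, ← cfc_const_add ε f x]
    conv_lhs => rw [← cfc_id' ℝ x]
    refine cfc_mono fun t _ => ?_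
    have := le_max_left (t - ε) 0
    simp only [hf]; linarith
  have hxyy : x * y = (ε : ℂ) • y + y * y := by
    have h0 : x * y = cfc (fun t : ℝ => t * f t) x := by
      rw [cfc_mul (fun t => t) f x, cfc_id' ℝ x]
    rw [h0, Complex.coe_smul, hy_def, ← cfc_const_mul ε f x, ← cfc_mul f f x, ← cfc_add _ _ _]
    refine cfc_congr fun t _ => ?_
    simp only [hf]
    rcases max_cases (t - ε) 0 with h | h <;> rw [h.1]
    · ring
    · simp
  have hysa : IsSelfAdjoint y := hy0.isSelfAdjoint
  obtain ⟨u, hu, hyu, hlim⟩ :=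
    hτ.exists_polar ((CStarAlgebra.norm_le_one_iff_of_nonneg y hy0).mpr hy1)
  refine ⟨star u * u, y, ⟨?_, IsSelfAdjoint.star_mul_self u⟩, hy0, hy1, hxy, ?_, ?_⟩
  · rw [IsIdempotentElem, mul_assoc, ← mul_assoc u, hu]
  · rw [mul_sub, mul_one, sub_eq_zero] at hyu
    exact hyu.symm
  · have hpos : 0 ≤ 1 - star u * u := by
      rw [sub_nonneg, ← CStarAlgebra.norm_le_one_iff_of_nonneg _ (star_mul_self_nonneg u),
        CStarRing.norm_star_mul_self]
      have := norm_le_one_of_isPartialIsometry hu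
      exact mul_le_one₀ this (norm_nonneg _) this
    have h1 := hτ.re_mul_nonneg hx0 hpos
    rw [mul_sub, mul_one, map_sub, Complex.sub_re] at h1
    have hlim2 := hτ.isBoundedLimit_mul (hτ.isBoundedLimit_star hlim) hlim
    have h2 : 0 ≤ (τ ((x - (ε : ℂ) • 1) * (star u * u))).re := by
      refine ge_of_tendsto ((Complex.continuous_re.tendsto _).comp
        (hτ.tendsto_trace (hτ.continuous_mul_left (x - (ε : ℂ) • 1) hlim2.2)))
        (Eventually.of_forall fun n => ?_)
      set r := aeval (star y * y) (newtonPoly n)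
      have hrsa : star r = r := star_aeval_of_isSelfAdjoint (IsSelfAdjoint.star_mul_self y) _
      have hcomm : y * r = r * y := by
        have h3 : Commute y (star y * y) := by
          rw [hysa.star_eq]; exact (Commute.refl y).mul_right (Commute.refl y)
        exact h3.aeval_right _
      have h4 : τ ((x - (ε : ℂ) • 1) * (star (y * r) * (y * r)))
          = τ (star r * (y * y * y) * r) := by
        rw [← mul_assoc, hτ.tracial]
        congr 1
        have h5 : (x - (ε : ℂ) • 1) * y = y * y := by
          rw [sub_mul, hxyy]; simp
        calc y * r * ((x - (ε : ℂ) • 1) * star (y * r))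
            = r * y * (((x - (ε : ℂ) • 1) * y) * r) := by
              rw [star_mul, hrsa, hysa.star_eq, ← hcomm]; simp only [mul_assoc]
          _ = _ := by rw [h5, hrsa]; simp only [mul_assoc]
      simp only [Function.comp_apply]
      rw [h4]
      apply hτ.re_nonneg
      apply star_left_conjugate_nonneg
      exact conjugate_nonneg_of_nonneg hy0 hy0
    rw [sub_mul, map_sub, smul_mul_assoc, one_mul, map_smul, Complex.sub_re, smul_eq_mul,
      Complex.re_ofReal_mul] at h2
    linarith

/-- In a finite factor, a projection `e` with `k τ(e) ≤ 1` has `k` orthogonal copies. -/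
theorem IsCompleteTrace.exists_projection_multiple (hτ : IsCompleteTrace τ ι)
    (hfac : ∀ x : A, (∀ y, x * y = y * x) → ∃ c : ℂ, x = c • 1) {φ : A →ₗ[ℂ] ℂ}
    (hφ : ∀ x y, φ (x * y) = φ (y * x)) {e : A} (he : IsStarProjection e) (k : ℕ)
    (hk : k * (τ e).re ≤ 1) :
    ∃ f, IsStarProjection f ∧ (τ f).re = k * (τ e).re ∧ (φ f).re = k * (φ e).re := by
  induction k with
  | zero => exact ⟨0, .zero A, by simp, by simp⟩
  | succ k ih =>
    let _ : PartialOrder A := CStarAlgebra.spectralOrder A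
    have _ : StarOrderedRing A := CStarAlgebra.spectralOrderedRing A
    have he0 : 0 ≤ (τ e).re := hτ.re_nonneg he.nonneg
    push_cast at hk
    obtain ⟨f, hf, hτf, hφf⟩ := ih (by linarith)
    obtain ⟨v, hv, hfv⟩ := hτ.exists_partialIsometry_of_le hfac he hf.one_sub (by
      rw [map_sub, hτ.map_one, Complex.sub_re, hτf, Complex.one_re]; linarith)
    have hfv0 : f * v = 0 := by
      rw [← hfv, ← mul_assoc, hf.mul_one_sub_self, zero_mul]
    have hve : v * e = v := by
      have h1 : star (v * (1 - e)) * (v * (1 - e)) = 0 := by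
        rw [star_mul, mul_assoc, ← mul_assoc (star v), hv, he.mul_one_sub_self, mul_zero]
      rw [CStarRing.star_mul_self_eq_zero_iff, mul_sub, mul_one, sub_eq_zero] at h1
      exact h1.symm
    refine ⟨f + v * star v, hf.add ⟨?_, IsSelfAdjoint.mul_star_self v⟩ ?_, ?_, ?_⟩
    · rw [IsIdempotentElem, mul_assoc, ← mul_assoc (star v), hv, ← mul_assoc, hve]
    · rw [← mul_assoc, hfv0, zero_mul]
    · rw [map_add, Complex.add_re, hτf, hτ.tracial, hv]; push_cast; ring
    · rw [map_add, Complex.add_re, hφf, hφ, hv]; push_cast; ring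

/-- Every tracial state on a finite factor is continuous for the `2`-norm on norm-bounded sets. -/
theorem IsCompleteTrace.re_tracialState_le (hτ : IsCompleteTrace τ ι)
    (hfac : ∀ x : A, (∀ y, x * y = y * x) → ∃ c : ℂ, x = c • 1) {φ : A →ₗ[ℂ] ℂ}
    (hφ : ∀ x y, φ (x * y) = φ (y * x)) (hφ1 : φ 1 = 1) (hφpos : ∀ x, 0 ≤ (φ (star x * x)).re)
    {z : A} {C : ℝ} (hC : 0 < C) (hz : ‖z‖ ≤ C) :
    (φ (star z * z)).re ≤ (C ^ 2 + 2) * ‖ι z‖ := by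
  let _ : PartialOrder A := CStarAlgebra.spectralOrder A
  have _ : StarOrderedRing A := CStarAlgebra.spectralOrderedRing A
  have hφnn {x : A} (hx : 0 ≤ x) : 0 ≤ (φ x).re := by
    obtain ⟨y, rfl⟩ := CStarAlgebra.nonneg_iff_eq_star_mul_self.mp hx
    exact hφpos y
  have hφmono {x y : A} (hxy : x ≤ y) : (φ x).re ≤ (φ y).re := by
    simpa using hφnn (sub_nonneg.mpr hxy)
  have hproj {e : A} (he : IsStarProjection e) : (φ e).re ≤ 2 * (τ e).re := by
    have he0 : 0 ≤ (τ e).re := hτ.re_nonneg he.nonneg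
    rcases he0.eq_or_lt with h0 | hpos
    · rw [hτ.eq_zero_of_nonneg he.nonneg h0.symm]; simp
    -- `e` has `⌊1 / τ(e)⌋ ≥ 1 / (2 τ(e))` orthogonal copies, on which `φ` takes the same value
    set t := (τ e).re
    have ht1 : t ≤ 1 := by
      have := hτ.re_nonneg he.one_sub.nonneg
      rw [map_sub, hτ.map_one, Complex.sub_re, Complex.one_re] at this
      linarith
    have hk1 : 1 ≤ ⌊1 / t⌋₊ := Nat.le_floor (by rw [Nat.cast_one, le_div_iff₀ hpos]; linarith)
    have hk2 : (⌊1 / t⌋₊ : ℝ) * t ≤ 1 := by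
      rw [← le_div_iff₀ hpos]; exact Nat.floor_le (by positivity)
    have hk3 : 1 < (⌊1 / t⌋₊ + 1 : ℝ) * t := by
      rw [← div_lt_iff₀ hpos]; exact Nat.lt_floor_add_one _
    set k := ⌊1 / t⌋₊
    obtain ⟨f, hf, -, hφf⟩ := hτ.exists_projection_multiple hfac hφ he k hk2
    have h2 := hφnn hf.one_sub.nonneg
    rw [map_sub, hφ1, Complex.sub_re, Complex.one_re, hφf] at h2
    have hk1' : (1 : ℝ) ≤ k := by exact_mod_cast hk1
    have h3 : (k : ℝ) * (φ e).re ≤ k * (2 * t) := by nlinarith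
    exact le_of_mul_le_mul_left h3 (by linarith)
  have hcontr {x : A} (hx0 : 0 ≤ x) (hx1 : x ≤ 1) {ε : ℝ} (hε : 0 < ε) :
      (φ x).re ≤ ε + 2 * (τ x).re / ε := by
    obtain ⟨e, y, he, hy0, hy1, hxy, hye, hτe⟩ := hτ.exists_spectralProjection hx0 hx1 hε.le
    have h1 : (φ x).re ≤ ε + (φ y).re := by
      refine (hφmono hxy).trans_eq ?_
      rw [map_add, map_smul, hφ1]; simp
    have h2 : (φ y).re ≤ (φ e).re := by
      have h3 := hφmono (star_left_conjugate_le_conjugate hy1 e)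
      have hee : e * e = e := he.isIdempotentElem
      have hes : star e = e := he.isSelfAdjoint
      rw [mul_one, hes, hee, mul_assoc, hφ, mul_assoc, hee, hye] at h3
      exact h3
    have h4 : 2 * (τ e).re ≤ 2 * (τ x).re / ε := by
      rw [le_div_iff₀ hε]; linarith
    linarith [hproj he]
  rcases eq_or_ne z 0 with rfl | hz0
  · simp
  have hιpos : 0 < ‖ι z‖ := norm_pos_iff.mpr fun h0 => hz0 (hτ.injective z h0)
  set x : A := ((C⁻¹ ^ 2 : ℝ) : ℂ) • (star z * z) with hx
  have hx' : x = star (((C⁻¹ : ℝ) : ℂ) • z) * (((C⁻¹ : ℝ) : ℂ) • z) := by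
    rw [hx, star_smul, smul_mul_smul_comm]
    congr 1
    rw [Complex.star_def, Complex.conj_ofReal, ← Complex.ofReal_mul, sq]
  have hx0 : 0 ≤ x := hx' ▸ star_mul_self_nonneg _
  have hx1 : x ≤ 1 := by
    rw [← CStarAlgebra.norm_le_one_iff_of_nonneg x hx0, hx', CStarRing.norm_star_mul_self,
      norm_smul,
      Complex.norm_real, norm_inv, Real.norm_of_nonneg hC.le]
    have : C⁻¹ * ‖z‖ ≤ 1 := by
      rw [inv_mul_le_iff₀ hC]; linarith
    exact mul_le_one₀ this (by positivity) this
  -- `ε = ‖z‖₂` balances `ε` and `‖z‖₂² / ε`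
  have h1 := hcontr hx0 hx1 hιpos
  rw [hx, map_smul, map_smul, smul_eq_mul, smul_eq_mul,
    Complex.re_ofReal_mul, Complex.re_ofReal_mul,
    ← hτ.norm_map_sq] at h1
  have h2 : (C⁻¹ ^ 2) * (φ (star z * z)).re ≤ C⁻¹ ^ 2 * ((C ^ 2 + 2) * ‖ι z‖) := by
    refine h1.trans_eq ?_
    field_simp
  exact le_of_mul_le_mul_left h2 (by positivity)

end Comparison

/-! ### Cocycles of free gradings -/

section Cocycle

open Filter Topology

variable {G : Type*} [Group G] [Fintype G] [DecidableEq G] {A : Type*} [CStarAlgebra A]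
  {E : Type*} [NormedAddCommGroup E] [InnerProductSpace ℂ E] [CompleteSpace E]
  {τ : A →ₗ[ℂ] ℂ} {ι : A →ₗ[ℂ] E} {δ : G → A →ₗ[ℂ] A}

/-- The projections of a grading of a finite factor are continuous for the `2`-norm on norm-bounded
sets, because `τ ∘ δ 1` is a tracial state. -/
theorem IsCompleteTrace.tendsto_grading (hτ : IsCompleteTrace τ ι)
    (hfac : ∀ x : A, (∀ y, x * y = y * x) → ∃ c : ℂ, x = c • 1) (hδ : IsGrading δ)
    {x : ℕ → A} {y : A} (hxy : IsBoundedLimit ι x y) (g : G) :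
    Tendsto (fun n => ι (δ g (x n))) atTop (𝓝 (ι (δ g y))) := by
  set φ : A →ₗ[ℂ] ℂ := τ ∘ₗ δ 1 with hφ
  have hφsq (z : A) : (φ (star z * z)).re = ∑ g, ‖ι (δ g z)‖ ^ 2 := by
    rw [hφ, LinearMap.comp_apply, hδ.map_one_star_mul_self, map_sum, Complex.re_sum]
    simp only [hτ.norm_map_sq]
  have hφtr (a b : A) : φ (a * b) = φ (b * a) := by
    simp only [hφ, LinearMap.comp_apply, hδ.map_mul, map_sum]
    refine Fintype.sum_equiv (Equiv.inv G) _ _ fun g => ?_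
    rw [hτ.tracial]; simp
  have hφ1 : φ 1 = 1 := by simp [hφ, hδ.map_one, hτ.map_one]
  obtain ⟨⟨C, hC⟩, hlim⟩ := hxy
  set B := C + ‖y‖ + 1
  have hC0 : 0 ≤ C := (norm_nonneg _).trans (hC 0)
  have hB : 0 < B := by positivity
  rw [tendsto_iff_norm_sub_tendsto_zero] at hlim ⊢
  have h0 : Tendsto (fun n => Real.sqrt ((B ^ 2 + 2) * ‖ι (x n) - ι y‖)) atTop (𝓝 0) := by
    simpa using (hlim.const_mul (B ^ 2 + 2)).sqrt
  refine squeeze_zero (fun _ => norm_nonneg _) (fun n => Real.le_sqrt_of_sq_le ?_) h0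
  rw [← map_sub, ← map_sub, ← map_sub]
  have hnorm : ‖x n - y‖ ≤ B := (norm_sub_le _ _).trans (by have := hC n; simp only [B]; linarith)
  refine le_trans ?_ (hτ.re_tracialState_le hfac hφtr hφ1
    (fun z => by rw [hφsq]; positivity) hB hnorm)
  rw [hφsq]
  exact Finset.single_le_sum (f := fun g => ‖ι (δ g (x n - y))‖ ^ 2) (fun _ _ => by positivity)
    (Finset.mem_univ g)

/-- A unitary `1`-cocycle of a free grading of a finite factor is a coboundary. The solutions `v` of
`δ g v = v w g` form a closed ternary ring of operators, and by the averaging lemma a maximal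
partial isometry in it is unitary. -/
theorem IsCompleteTrace.exists_unitary_of_cocycle (hτ : IsCompleteTrace τ ι)
    (hfac : ∀ x : A, (∀ y, x * y = y * x) → ∃ c : ℂ, x = c • 1) (hδ : IsGrading δ)
    (hfree : IsFreeGrading δ) {w : G → A} (hsum : ∑ g, w g = 1)
    (hunit : ∀ g, ∑ k, w (g * k) * star (w k) = if g = 1 then 1 else 0)
    (hcoc : ∀ g h, star (w g) * w h = δ (g⁻¹ * h) (w h)) :
    ∃ v ∈ unitary A, ∀ g, δ g v = v * w g := by
  let X : Submodule ℂ A :=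
    { carrier := {v | ∀ g, δ g v = v * w g}
      add_mem' := fun ha hb g => by rw [map_add, ha g, hb g, add_mul]
      zero_mem' := fun g => by simp
      smul_mem' := fun c a ha g => by rw [map_smul, ha g, smul_mul_assoc] }
  have hX : IsClosedTRO ι X := by
    constructor
    · intro x hx y hy z hz g
      have h1 (g : G) : δ g (x * star y) = if g = 1 then x * star y else 0 := by
        calc δ g (x * star y) = x * (∑ a, w a * star (w (g⁻¹ * a))) * star y := by
              rw [hδ.map_mul, Finset.mul_sum, Finset.sum_mul]
              refine Finset.sum_congr rfl fun a _ => ?_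
              rw [hδ.map_star, hx a, hy, star_mul]
              simp [mul_assoc]
          _ = x * (∑ k, w (g * k) * star (w k)) * star y := by
              congr 2
              exact Fintype.sum_equiv (Equiv.mulLeft g⁻¹) _ _ fun a => by simp
          _ = _ := by rw [hunit]; split_ifs <;> simp
      rw [hδ.map_mul, Finset.sum_eq_single 1]
      · rw [h1, if_pos rfl, inv_one, one_mul, hz g, mul_assoc, mul_assoc, mul_assoc]
      · intro a _ ha; rw [h1, if_neg ha, zero_mul]
      · simp
    · intro x y hx hxy g
      have h1 := hτ.tendsto_grading hfac hδ hxy g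
      have h2 := hτ.continuous_mul_right (w g) hxy.2
      simp only [hx _ g] at h1
      exact sub_eq_zero.mp (hτ.injective _ (by rw [map_sub, tendsto_nhds_unique h1 h2, sub_self]))
  -- `y ↦ ∑ₕ δ h (y) w(h)*` is the projection of `A` onto `X`
  have hproj (y : A) : ∑ h, δ h y * star (w h) ∈ X := fun g => by
    rw [map_sum, Finset.sum_mul]
    refine Finset.sum_congr rfl fun h _ => ?_
    rw [hδ.map_mul, Finset.sum_eq_single h]
    · rw [hδ.apply_apply, if_pos rfl, hδ.map_star, mul_inv_rev, inv_inv, ← hcoc,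
        star_mul, star_star, mul_assoc]
    · intro a _ ha; rw [hδ.apply_apply, if_neg ha, zero_mul]
    · simp
  obtain ⟨v, hvX, hv, hmax⟩ := hτ.exists_maximal_partialIsometry hX
  have hv' : star v * v * star v = star v := by simpa [mul_assoc] using congrArg star hv
  set p := 1 - v * star v with hp
  set q := 1 - star v * v with hq
  have hpp : star p * p = p := by
    rw [hp, star_sub, star_one, star_mul, star_star, sub_mul, one_mul, mul_sub, mul_one,
      ← mul_assoc, hv, sub_self, sub_zero]
  have hqq : star q * q = q := by
    rw [hq, star_sub, star_one, star_mul, star_star, sub_mul, one_mul, mul_sub, mul_one,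
      ← mul_assoc, hv', sub_self, sub_zero]
  have hτpq : τ p = τ q := by rw [hp, hq, map_sub, map_sub, hτ.tracial]
  have hrel := hτ.smul_eq_zero_of_relation hδ hfree p (fun h => star (w h) * q) fun x => by
    have h1 := hmax _ (hproj x)
    rw [mul_assoc, Finset.sum_mul] at h1
    simpa only [mul_assoc] using h1
  have hsum' : ∑ h, star (w h) * q = q := by
    rw [← Finset.sum_mul, ← star_sum, hsum, star_one, one_mul]
  rw [hsum'] at hrel
  have hzero {r : A} (hr : star r * r = r) (h0 : τ r = 0) : r = 0 := by
    apply hτ.injective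
    have := hτ.norm_map_sq r
    rw [hr, h0, Complex.zero_re] at this
    simpa using this
  have hp0 : p = 0 := by
    rcases smul_eq_zero.mp hrel with h0 | h0
    · exact hzero hpp (hτpq.trans h0)
    · exact h0
  have hq0 : q = 0 := hzero hqq (by rw [← hτpq, hp0, map_zero])
  exact ⟨v, Unitary.mem_iff.mpr ⟨(sub_eq_zero.mp hq0).symm, (sub_eq_zero.mp hp0).symm⟩, hvX⟩

end Cocycle

/-! ### The standard form of a von Neumann algebra with a faithful normal trace -/

section StandardForm

open Filter Topology
open scoped ENNReal

variable {H : Type*} [NormedAddCommGroup H] [InnerProductSpace ℂ H] [CompleteSpace H]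

instance VonNeumannAlgebra.isClosed (M : VonNeumannAlgebra H) :
    IsClosed (M.toStarSubalgebra : Set (H →L[ℂ] H)) := by
  rw [coe_toStarSubalgebra, ← centralizer_centralizer]
  exact Set.isClosed_centralizer _

instance VonNeumannAlgebra.cstarAlgebraElt (M : VonNeumannAlgebra H) : CStarAlgebra M.Elt :=
  StarSubalgebra.cstarAlgebra _

theorem VonNeumannAlgebra.mem_of_commute {M : VonNeumannAlgebra H} {x : H →L[ℂ] H}
    (hx : ∀ s ∈ M.commutant, s * x = x * s) : x ∈ M := by
  rw [← commutant_commutant M, mem_commutant_iff]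
  exact hx

theorem VonNeumannAlgebra.mul_comm_of_mem {M : VonNeumannAlgebra H} {x s : H →L[ℂ] H} (hx : x ∈ M)
    (hs : s ∈ M.commutant) : s * x = x * s :=
  (mem_commutant_iff.mp hs x hx).symm

/-- A norm-bounded sequence of operators which converges pointwise on a total set converges
pointwise. -/
theorem exists_tendsto_of_dense_span {x : ℕ → H →L[ℂ] H} {C : ℝ} (hC : ∀ n, ‖x n‖ ≤ C) {D : Set H}
    (hD : (Submodule.span ℂ D).topologicalClosure = ⊤)
    (hx : ∀ η ∈ D, ∃ ζ, Tendsto (fun n => x n η) atTop (𝓝 ζ)) (η : H) :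
    ∃ ζ, Tendsto (fun n => x n η) atTop (𝓝 ζ) := by
  have hspan : ∀ η ∈ Submodule.span ℂ D, ∃ ζ, Tendsto (fun n => x n η) atTop (𝓝 ζ) := by
    intro η hη
    induction hη using Submodule.span_induction with
    | mem η h => exact hx η h
    | zero => exact ⟨0, by simp⟩
    | add a b _ _ ha hb =>
      obtain ⟨ζ, hζ⟩ := ha
      obtain ⟨ζ', hζ'⟩ := hb
      exact ⟨ζ + ζ', by simpa using hζ.add hζ'⟩
    | smul c a _ ha =>
      obtain ⟨ζ, hζ⟩ := ha
      exact ⟨c • ζ, by simpa using hζ.const_smul c⟩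
  have hC0 : 0 ≤ C := (norm_nonneg _).trans (hC 0)
  apply cauchySeq_tendsto_of_complete
  rw [Metric.cauchySeq_iff']
  intro ε hε
  have hη : η ∈ closure (Submodule.span ℂ D : Set H) := by
    rw [← Submodule.topologicalClosure_coe, hD]; trivial
  obtain ⟨η', hη', hd⟩ := Metric.mem_closure_iff.mp hη (ε / (3 * (C + 1))) (by positivity)
  obtain ⟨ζ, hζ⟩ := hspan η' hη'
  obtain ⟨N, hN⟩ := Metric.cauchySeq_iff'.mp hζ.cauchySeq (ε / 3) (by positivity)
  refine ⟨N, fun n hn => ?_⟩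
  have h1 (m : ℕ) : ‖x m (η - η')‖ < ε / 3 := by
    rw [dist_eq_norm, lt_div_iff₀ (by positivity)] at hd
    have h2 := (x m).le_opNorm (η - η')
    have h3 : ‖x m‖ * ‖η - η'‖ ≤ C * ‖η - η'‖ := by gcongr; exact hC m
    nlinarith [norm_nonneg (η - η')]
  have h2 := hN n hn
  rw [dist_eq_norm] at h2 ⊢
  have e : x n η - x N η = x n (η - η') + (x n η' - x N η') - x N (η - η') := by
    simp only [map_sub]; abel
  rw [e]
  calc _ ≤ ‖x n (η - η') + (x n η' - x N η')‖ + ‖x N (η - η')‖ := norm_sub_le _ _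
    _ ≤ ‖x n (η - η')‖ + ‖x n η' - x N η'‖ + ‖x N (η - η')‖ := by gcongr; exact norm_add_le _ _
    _ < ε := by linarith [h1 n, h1 N]

/-- The map `x ↦ (x ξₙ)ₙ` from `M` to `ℓ²(ℕ, H)`. -/
def vectorMap (M : VonNeumannAlgebra H) (ξ : ℕ → H) (hξ : Summable fun n => ‖ξ n‖ ^ 2) :
    M.Elt →ₗ[ℂ] lp (fun _ : ℕ => H) 2 where
  toFun x := ⟨fun n => (x : H →L[ℂ] H) (ξ n), by
    refine memℓp_gen ?_
    simp only [ENNReal.toReal_ofNat, Real.rpow_ofNat]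
    refine Summable.of_nonneg_of_le (fun _ => by positivity) (fun n => ?_)
      (hξ.mul_left (‖(x : H →L[ℂ] H)‖ ^ 2))
    rw [← mul_pow]
    exact pow_le_pow_left₀ (norm_nonneg _) ((x : H →L[ℂ] H).le_opNorm _) 2⟩
  map_add' x y := by ext n; rfl
  map_smul' c x := by ext n; rfl

/-- A von Neumann algebra with a faithful normal tracial state is complete in the `2`-norm, on
norm-bounded sets: the vectors which implement the trace are separating for `M`, hence cyclic for
its commutant, so that `2`-norm convergence implies strong convergence. -/
theorem VonNeumannAlgebra.IsFaithfulNormalTracialState.exists_isCompleteTrace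
    {M : VonNeumannAlgebra H} {τ : M.Elt →ₗ[ℂ] ℂ} (hτ : M.IsFaithfulNormalTracialState τ) :
    ∃ ι : M.Elt →ₗ[ℂ] lp (fun _ : ℕ => H) 2, IsCompleteTrace τ ι := by
  obtain ⟨ξ, hξ, hsum⟩ := hτ.normal
  have hinner (x y : M.Elt) :
      ⟪vectorMap M ξ hξ x, vectorMap M ξ hξ y⟫_ℂ = τ (star x * y) := by
    refine (lp.hasSum_inner (𝕜 := ℂ) (vectorMap M ξ hξ x) (vectorMap M ξ hξ y)).unique ?_
    have e : (fun n => ⟪vectorMap M ξ hξ x n, vectorMap M ξ hξ y n⟫_ℂ)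
        = fun n => ⟪ξ n, (star x * y : M.Elt).1 (ξ n)⟫_ℂ := funext fun n =>
      (ContinuousLinearMap.adjoint_inner_right (x : H →L[ℂ] H) (ξ n)
      ((y : H →L[ℂ] H) (ξ n))).symm
    rw [e]
    exact hsum _
  have hinj (x : M.Elt) (hx : vectorMap M ξ hξ x = 0) : x = 0 :=
    hτ.faithful x (by rw [← hinner, hx, inner_zero_left])
  set D : Set H := {η | ∃ s ∈ M.commutant, ∃ n, η = s (ξ n)} with hD_def
  have hDinv (s : H →L[ℂ] H) (hs : s ∈ M.commutant) :
      ∀ η ∈ (Submodule.span ℂ D).topologicalClosure,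
        s η ∈ (Submodule.span ℂ D).topologicalClosure := by
    have h1 : Set.MapsTo s (Submodule.span ℂ D : Set H) (Submodule.span ℂ D : Set H) := by
      intro η hη
      have : Submodule.span ℂ D ≤ (Submodule.span ℂ D).comap (s : H →ₗ[ℂ] H) := by
        rw [Submodule.span_le]
        rintro _ ⟨t, ht, n, rfl⟩
        exact Submodule.subset_span ⟨s * t, mul_mem hs ht, n, rfl⟩
      exact this hη
    intro η hη
    exact h1.closure s.continuous hη
  have hD : (Submodule.span ℂ D).topologicalClosure = ⊤ := by
    set K := (Submodule.span ℂ D).topologicalClosure with hK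
    have hKc : IsClosed (K : Set H) := Submodule.isClosed_topologicalClosure _
    have : CompleteSpace K := hKc.completeSpace_coe
    have hPM : K.starProjection ∈ M := by
      rw [VonNeumannAlgebra.IsStarProjection.mem_iff isStarProjection_starProjection]
      intro y hy
      rw [Submodule.range_starProjection]
      exact fun η hη => hDinv y hy η hη
    have h0 : (1 : M.Elt) - ⟨K.starProjection, hPM⟩ = 0 := by
      apply hinj
      ext n
      change ξ n - K.starProjection (ξ n) = 0
      rw [Submodule.starProjection_eq_self_iff.mpr, sub_self]
      exact Submodule.le_topologicalClosure _ (Submodule.subset_span ⟨1, one_mem _, n, rfl⟩)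
    have h1 : K.starProjection = 1 := (congrArg Subtype.val (sub_eq_zero.mp h0)).symm
    rw [eq_top_iff]
    intro η _
    rw [← Submodule.starProjection_eq_self_iff, h1]
    rfl
  refine ⟨vectorMap M ξ hξ, hτ.map_one, hτ.tracial, hinner, hinj, fun C x ζ hC hlim => ?_⟩
  have hcoord (k : ℕ) : Tendsto (fun n => (x n : H →L[ℂ] H) (ξ k)) atTop (𝓝 (ζ k)) := by
    rw [tendsto_iff_norm_sub_tendsto_zero] at hlim ⊢
    refine squeeze_zero (fun _ => norm_nonneg _) (fun n => ?_) hlim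
    exact lp.norm_apply_le_norm two_ne_zero (vectorMap M ξ hξ (x n) - ζ) k
  choose f hf using exists_tendsto_of_dense_span (x := fun n => (x n : H →L[ℂ] H)) hC hD (by
    rintro _ ⟨s, hs, k, rfl⟩
    refine ⟨s (ζ k), (((s.continuous.tendsto _).comp (hcoord k))).congr fun n => ?_⟩
    exact congrArg (fun T : H →L[ℂ] H => T (ξ k)) (mul_comm_of_mem (x n).2 hs))
  set T : H →L[ℂ] H := continuousLinearMapOfTendsto (fun n => (x n : H →L[ℂ] H))
    (tendsto_pi_nhds.mpr hf) with hT
  have hTf (η : H) : T η = f η := rfl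
  have hTM : T ∈ M := mem_of_commute fun s hs => by
    ext η
    refine tendsto_nhds_unique ((s.continuous.tendsto _).comp (hf η)) ((hf (s η)).congr fun n => ?_)
    exact congrArg (fun T : H →L[ℂ] H => T η) (mul_comm_of_mem (x n).2 hs).symm
  refine ⟨⟨T, hTM⟩, ?_⟩
  ext k
  exact tendsto_nhds_unique (hf (ξ k)) (hcoord k)

end StandardForm

/-! ### Schur orthogonality -/

section Schur

namespace UnitaryRep

variable {G : Type*} [Group G]

theorem mat_mul (π : UnitaryRep G) (g h : G) : π.mat (g * h) = π.mat g * π.mat h := by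
  simp [mat]

theorem mat_one (π : UnitaryRep G) : π.mat 1 = 1 := by
  simp [mat]

theorem mat_mul_conjTranspose (π : UnitaryRep G) (g : G) : π.mat g * (π.mat g)ᴴ = 1 :=
  Matrix.mem_unitaryGroup_iff.mp (π.toHom g).2

theorem conjTranspose_mul_mat (π : UnitaryRep G) (g : G) : (π.mat g)ᴴ * π.mat g = 1 :=
  Matrix.mem_unitaryGroup_iff'.mp (π.toHom g).2

theorem mat_inv (π : UnitaryRep G) (g : G) : π.mat g⁻¹ = (π.mat g)ᴴ := by
  have h1 : π.mat g⁻¹ * π.mat g = 1 := by rw [← mat_mul, inv_mul_cancel, mat_one]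
  calc π.mat g⁻¹ = π.mat g⁻¹ * (π.mat g * (π.mat g)ᴴ) := by rw [mat_mul_conjTranspose, mul_one]
    _ = _ := by rw [← mul_assoc, h1, one_mul]

theorem irreducible_iff (π : UnitaryRep G) : π.Irreducible ↔ 0 < π.dim ∧
    ∀ P : Submodule ℂ (Fin π.dim → ℂ), (∀ g, ∀ x ∈ P, π.mat g *ᵥ x ∈ P) → P = ⊥ ∨ P = ⊤ := by
  constructor
  · intro h
    have hs : IsSimpleOrder (Subrepresentation π.toRepresentation) := h
    refine ⟨Nat.pos_of_ne_zero fun h0 => ?_, fun P hP => ?_⟩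
    · have : IsEmpty (Fin π.dim) := by rw [h0]; infer_instance
      apply bot_ne_top (α := Subrepresentation π.toRepresentation)
      exact Subrepresentation.toSubmodule_injective (Subsingleton.elim _ _)
    · rcases hs.eq_bot_or_eq_top ⟨P, fun g x hx => hP g x hx⟩ with h1 | h1
      · exact Or.inl (congrArg Subrepresentation.toSubmodule h1)
      · exact Or.inr (congrArg Subrepresentation.toSubmodule h1)
  · rintro ⟨hd, h⟩
    have : Nonempty (Fin π.dim) := ⟨⟨0, hd⟩⟩
    exact
      { exists_pair_ne := ⟨⊥, ⊤, fun h0 => bot_ne_top (α := Submodule ℂ (Fin π.dim → ℂ))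
          (congrArg Subrepresentation.toSubmodule h0)⟩
        eq_bot_or_eq_top := fun P =>
          (h P.toSubmodule fun g x hx => P.apply_mem_toSubmodule g hx).imp
            (fun h1 => Subrepresentation.toSubmodule_injective h1)
            (fun h1 => Subrepresentation.toSubmodule_injective h1) }

/-- Schur's lemma. -/
theorem Irreducible.eq_smul_one {π : UnitaryRep G} (hπ : π.Irreducible)
    {B : Matrix (Fin π.dim) (Fin π.dim) ℂ} (hB : ∀ g, B * π.mat g = π.mat g * B) :
    ∃ c : ℂ, B = c • 1 := by
  obtain ⟨hd, hP⟩ := (irreducible_iff π).mp hπ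
  have : Nonempty (Fin π.dim) := ⟨⟨0, hd⟩⟩
  obtain ⟨c, hc⟩ := Module.End.exists_eigenvalue (Matrix.toLin' B)
  refine ⟨c, ?_⟩
  have hmem (x : Fin π.dim → ℂ) :
      x ∈ Module.End.eigenspace (Matrix.toLin' B) c ↔ B *ᵥ x = c • x := by
    rw [Module.End.mem_eigenspace_iff, Matrix.toLin'_apply]
  have htop := (hP (Module.End.eigenspace (Matrix.toLin' B) c) fun g x hx => by
    rw [hmem] at hx ⊢
    rw [Matrix.mulVec_mulVec, hB, ← Matrix.mulVec_mulVec, hx, Matrix.mulVec_smul]).resolve_left hc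
  apply Matrix.toLin'.injective
  ext1 i
  ext1
  have h1 := (hmem (Pi.single i 1)).mp (htop ▸ Submodule.mem_top)
  simp only [LinearMap.comp_apply, Matrix.toLin'_apply, LinearMap.single_apply]
  rw [h1, Matrix.smul_mulVec, Matrix.one_mulVec]

open ComplexOrder in
/-- Intertwiners between inequivalent irreducible representations vanish. -/
theorem Irreducible.equivalent_or_eq_zero {π ρ : UnitaryRep G} (hπ : π.Irreducible)
    (hρ : ρ.Irreducible) {S : Matrix (Fin ρ.dim) (Fin π.dim) ℂ}
    (hS : ∀ g, S * π.mat g = ρ.mat g * S) : π.Equivalent ρ ∨ S = 0 := by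
  have hS' (g : G) : Sᴴ * ρ.mat g = π.mat g * Sᴴ := by
    have h1 := congrArg Matrix.conjTranspose (hS g⁻¹)
    rw [Matrix.conjTranspose_mul, Matrix.conjTranspose_mul, mat_inv, mat_inv,
      Matrix.conjTranspose_conjTranspose, Matrix.conjTranspose_conjTranspose] at h1
    exact h1.symm
  obtain ⟨c, hc⟩ := hπ.eq_smul_one (B := Sᴴ * S) fun g => by
    rw [Matrix.mul_assoc, hS, ← Matrix.mul_assoc, hS', Matrix.mul_assoc]
  obtain ⟨c', hc'⟩ := hρ.eq_smul_one (B := S * Sᴴ) fun g => by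
    rw [Matrix.mul_assoc, hS', ← Matrix.mul_assoc, hS, Matrix.mul_assoc]
  by_cases hS0 : S = 0
  · exact Or.inr hS0
  left
  have hcc : c' = c := by
    have h1 : c' • S = c • S := by
      calc c' • S = (S * Sᴴ) * S := by rw [hc', Matrix.smul_mul, Matrix.one_mul]
        _ = S * (Sᴴ * S) := Matrix.mul_assoc _ _ _
        _ = c • S := by rw [hc, Matrix.mul_smul, Matrix.mul_one]
    rw [← sub_eq_zero, ← sub_smul, smul_eq_zero] at h1
    exact sub_eq_zero.mp (h1.resolve_right hS0)
  obtain ⟨hd, -⟩ := (irreducible_iff π).mp hπ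
  have hcdiag : c = ∑ i, star (S i ⟨0, hd⟩) * S i ⟨0, hd⟩ := by
    have := congrFun (congrFun hc ⟨0, hd⟩) ⟨0, hd⟩
    rw [Matrix.mul_apply] at this
    simpa using this.symm
  let r : ℝ := ∑ i, ‖S i ⟨0, hd⟩‖ ^ 2
  have hcr : c = (r : ℂ) := by
    rw [hcdiag]
    simp only [r, Complex.ofReal_sum]
    refine Finset.sum_congr rfl fun i _ => ?_
    rw [Complex.star_def, mul_comm, Complex.mul_conj, Complex.normSq_eq_norm_sq]
  have hr0 : 0 ≤ r := by positivity
  have hr : r ≠ 0 := by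
    intro h0
    rw [hcr, h0, Complex.ofReal_zero, zero_smul] at hc
    exact hS0 (Matrix.conjTranspose_mul_self_eq_zero.mp hc)
  have hsq : (((Real.sqrt r)⁻¹ : ℝ) : ℂ) * (((Real.sqrt r)⁻¹ : ℝ) : ℂ) * c = 1 := by
    rw [hcr, ← Complex.ofReal_mul, ← Complex.ofReal_mul, ← mul_inv, Real.mul_self_sqrt hr0,
      inv_mul_cancel₀ hr, Complex.ofReal_one]
  refine ⟨(((Real.sqrt r)⁻¹ : ℝ) : ℂ) • S, ?_, ?_, fun g => ?_⟩
  · rw [Matrix.conjTranspose_smul, Matrix.smul_mul, Matrix.mul_smul, hc, smul_smul, smul_smul,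
      Complex.star_def, Complex.conj_ofReal, hsq, one_smul]
  · rw [Matrix.conjTranspose_smul, Matrix.smul_mul, Matrix.mul_smul, hc', smul_smul, smul_smul,
      Complex.star_def, Complex.conj_ofReal, hcc, hsq, one_smul]
  · rw [Matrix.smul_mul, hS, Matrix.mul_smul]

variable [Fintype G]

/-- Averaging a matrix over `G` gives an intertwiner. -/
theorem sum_mul_mul_conjTranspose_intertwines (π ρ : UnitaryRep G)
    (B : Matrix (Fin ρ.dim) (Fin π.dim) ℂ) (h : G) :
    (∑ g, ρ.mat g * B * (π.mat g)ᴴ) * π.mat h = ρ.mat h * ∑ g, ρ.mat g * B * (π.mat g)ᴴ := by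
  rw [Matrix.sum_mul, Matrix.mul_sum]
  refine Fintype.sum_equiv (Equiv.mulLeft h⁻¹) _ _ fun g => ?_
  simp only [Equiv.coe_mulLeft, mat_mul, mat_inv, Matrix.conjTranspose_mul,
    Matrix.conjTranspose_conjTranspose]
  rw [← Matrix.mul_assoc (ρ.mat h), ← Matrix.mul_assoc (ρ.mat h), ← Matrix.mul_assoc (ρ.mat h),
    mat_mul_conjTranspose, Matrix.one_mul, Matrix.mul_assoc (ρ.mat g * B)]

theorem sum_mul_single_mul_apply (π ρ : UnitaryRep G) (i j : Fin ρ.dim) (k l : Fin π.dim) :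
    (∑ g, ρ.mat g * Matrix.single j l (1 : ℂ) * (π.mat g)ᴴ) i k
      = ∑ g, ρ.mat g i j * star (π.mat g k l) := by
  rw [Matrix.sum_apply]
  refine Finset.sum_congr rfl fun g _ => ?_
  rw [Matrix.mul_apply, Finset.sum_eq_single l]
  · simp
  · intro b _ hb
    rw [Matrix.mul_single_apply_of_ne _ _ _ _ _ hb, zero_mul]
  · simp

theorem Irreducible.sum_mul_star_of_not_equivalent {π ρ : UnitaryRep G} (hπ : π.Irreducible)
    (hρ : ρ.Irreducible) (h : ¬ π.Equivalent ρ) (i j : Fin ρ.dim) (k l : Fin π.dim) :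
    ∑ g, ρ.mat g i j * star (π.mat g k l) = 0 := by
  have := (hπ.equivalent_or_eq_zero hρ
    (sum_mul_mul_conjTranspose_intertwines π ρ (Matrix.single j l (1 : ℂ)))).resolve_left h
  rw [← sum_mul_single_mul_apply, this, Matrix.zero_apply]

theorem Irreducible.sum_mul_star {π : UnitaryRep G} (hπ : π.Irreducible) (i j k l : Fin π.dim) :
    π.dim * ∑ g, π.mat g i j * star (π.mat g k l)
      = if i = k ∧ j = l then (Fintype.card G : ℂ) else 0 := by
  obtain ⟨c, hc⟩ := hπ.eq_smul_one fun g =>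
    sum_mul_mul_conjTranspose_intertwines π π (Matrix.single j l (1 : ℂ)) g
  have htr := congrArg Matrix.trace hc
  have h1 (g : G) : Matrix.trace (π.mat g * Matrix.single j l (1 : ℂ) * (π.mat g)ᴴ)
      = if j = l then 1 else 0 := by
    rw [Matrix.trace_mul_comm, ← Matrix.mul_assoc, conjTranspose_mul_mat, Matrix.one_mul]
    split_ifs with h
    · rw [h, Matrix.trace_single_eq_same]
    · rw [Matrix.trace_single_eq_of_ne _ _ _ h]
  rw [Matrix.trace_sum, Matrix.trace_smul, Matrix.trace_one, Fintype.card_fin] at htr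
  simp only [h1] at htr
  rw [← sum_mul_single_mul_apply, hc, Matrix.smul_apply, Matrix.one_apply, smul_eq_mul]
  simp only [Finset.sum_const, Finset.card_univ, nsmul_eq_mul, smul_eq_mul] at htr
  rw [← mul_assoc, mul_comm (π.dim : ℂ), ← htr]
  by_cases h2 : i = k <;> by_cases h3 : j = l <;> simp [h2, h3]

end UnitaryRep

end Schur

/-! ### Complete reducibility and Fourier inversion -/

section Fourier

namespace UnitaryDual

variable {G : Type*} [Group G] (D : UnitaryDual G)

/-- Complete reducibility: a vector-valued linear functional on the space of a unitary
representation `μ` vanishes if it vanishes on the ranges of all intertwiners from irreducible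
representations. Otherwise the orthogonal complement of the span of these ranges would contain a
minimal invariant subspace. -/
theorem eq_zero_of_forall_intertwiner {n : Type*} [Fintype n] [DecidableEq n]
    (μ : G →* Matrix.unitaryGroup n ℂ) {V : Type*} [AddCommGroup V] [Module ℂ V] (a : n → V)
    (ha : ∀ (σ : D.Elt) (T : Matrix n (D.Idx σ) ℂ),
      (∀ g, T * σ.1.mat g = (μ g : Matrix n n ℂ) * T) → ∀ k, ∑ j, T j k • a j = 0) :
    a = 0 := by
  let m (g : G) : EuclideanSpace ℂ n →ₗ[ℂ] EuclideanSpace ℂ n :=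
    Matrix.toEuclideanLin (μ g : Matrix n n ℂ)
  have hm_apply (g : G) (x : EuclideanSpace ℂ n) (j : n) :
      m g x j = ∑ i, (μ g : Matrix n n ℂ) j i * x i := rfl
  have hm_adj (g : G) (x y : EuclideanSpace ℂ n) : ⟪m g x, y⟫_ℂ = ⟪x, m g⁻¹ y⟫_ℂ := by
    have h1 : (μ g⁻¹ : Matrix n n ℂ) = (μ g : Matrix n n ℂ)ᴴ := by
      rw [map_inv]; rfl
    simp only [m]
    rw [h1, Matrix.toEuclideanLin_conjTranspose_eq_adjoint, LinearMap.adjoint_inner_right]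
  let W : Submodule ℂ (EuclideanSpace ℂ n) := Submodule.span ℂ
    {x | ∃ (σ : D.Elt) (T : Matrix n (D.Idx σ) ℂ) (k : D.Idx σ),
      (∀ g, T * σ.1.mat g = (μ g : Matrix n n ℂ) * T) ∧ x = WithLp.toLp 2 fun j => T j k}
  have hWm (g : G) : ∀ x ∈ W, m g x ∈ W := by
    intro x hx
    have : W ≤ W.comap (m g) := by
      rw [Submodule.span_le]
      rintro _ ⟨σ, T, k, hT, rfl⟩
      have e : m g (WithLp.toLp 2 fun j => T j k)
          = ∑ l, σ.1.mat g l k • (WithLp.toLp 2 fun j => T j l : EuclideanSpace ℂ n) := by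
        ext j
        have := congrFun (congrFun (hT g) j) k
        rw [Matrix.mul_apply, Matrix.mul_apply] at this
        rw [hm_apply, ← this]
        simp [mul_comm]
      rw [SetLike.mem_coe, Submodule.mem_comap, e]
      exact Submodule.sum_mem _ fun l _ =>
        Submodule.smul_mem _ _ (Submodule.subset_span ⟨σ, T, l, hT, rfl⟩)
    exact this hx
  have hWtop : W = ⊤ := by
    by_contra hne
    -- a nonzero invariant subspace of `Wᗮ` of least dimension
    let inv (K : Submodule ℂ (EuclideanSpace ℂ n)) : Prop :=
      K ≤ Wᗮ ∧ K ≠ ⊥ ∧ ∀ g, ∀ x ∈ K, m g x ∈ K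
    have hex : ∃ d K, inv K ∧ Module.finrank ℂ K = d := by
      refine ⟨_, Wᗮ, ⟨le_rfl, fun h0 => hne (Submodule.orthogonal_eq_bot_iff.mp h0),
        fun g x hx => ?_⟩, rfl⟩
      rw [Submodule.mem_orthogonal'] at hx ⊢
      intro y hy
      rw [hm_adj]
      exact hx _ (hWm _ _ hy)
    classical
    obtain ⟨K, ⟨hKW, hK0, hKm⟩, hKd⟩ := Nat.find_spec hex
    have hKmin (K' : Submodule ℂ (EuclideanSpace ℂ n)) (h : inv K') :
        Module.finrank ℂ K ≤ Module.finrank ℂ K' := by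
      rw [hKd]; exact Nat.find_min' hex ⟨K', h, rfl⟩
    clear hKd
    set d := Module.finrank ℂ K with hd
    let b : OrthonormalBasis (Fin d) ℂ K := stdOrthonormalBasis ℂ K
    let S : Matrix n (Fin d) ℂ := Matrix.of fun j i => (b i : EuclideanSpace ℂ n) j
    have hSS : Sᴴ * S = 1 := by
      ext i k
      have h1 : ⟪(b i : EuclideanSpace ℂ n), (b k : EuclideanSpace ℂ n)⟫_ℂ
          = if i = k then 1 else 0 := orthonormal_iff_ite.mp b.orthonormal i k
      rw [Matrix.one_apply, ← h1, Matrix.mul_apply, PiLp.inner_apply]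
      refine Finset.sum_congr rfl fun j _ => ?_
      rw [RCLike.inner_apply, mul_comm]; rfl
    have hSm (g : G) : S * (Sᴴ * (μ g : Matrix n n ℂ) * S) = (μ g : Matrix n n ℂ) * S := by
      ext j i
      have hmem : m g (b i) ∈ K := hKm g _ (b i).2
      have h1 := congrArg (fun z : K => (z : EuclideanSpace ℂ n) j) (b.sum_repr' ⟨m g (b i), hmem⟩)
      simp only at h1
      have h2 : m g (b i) j = ((μ g : Matrix n n ℂ) * S) j i := by
        rw [hm_apply, Matrix.mul_apply]; rfl
      rw [← h2, ← h1, Submodule.coe_sum, Matrix.mul_apply, WithLp.ofLp_sum, Finset.sum_apply]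
      refine Finset.sum_congr rfl fun l _ => ?_
      have h3 : ⟪(b l : EuclideanSpace ℂ n), m g (b i)⟫_ℂ
            = (Sᴴ * (μ g : Matrix n n ℂ) * S) l i := by
        rw [Matrix.mul_assoc, Matrix.mul_apply, PiLp.inner_apply]
        refine Finset.sum_congr rfl fun j _ => ?_
        rw [RCLike.inner_apply, mul_comm, hm_apply, Matrix.mul_apply]; rfl
      rw [← h3, mul_comm]; rfl
    have hμu (g : G) : (μ g : Matrix n n ℂ)ᴴ * (μ g : Matrix n n ℂ) = 1 :=
      Matrix.mem_unitaryGroup_iff'.mp (μ g).2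
    let σ : UnitaryRep G :=
      { dim := d
        toHom :=
          { toFun := fun g => ⟨Sᴴ * (μ g : Matrix n n ℂ) * S, by
              rw [Matrix.mem_unitaryGroup_iff', Matrix.star_eq_conjTranspose,
                Matrix.conjTranspose_mul, Matrix.conjTranspose_mul,
                Matrix.conjTranspose_conjTranspose, Matrix.mul_assoc, Matrix.mul_assoc, hSm,
                ← Matrix.mul_assoc ((μ g : Matrix n n ℂ)ᴴ), hμu, Matrix.one_mul, hSS]⟩
            map_one' := by
              ext1
              simp [hSS]
            map_mul' := fun g h => by
              ext1
              simp only [map_mul, Submonoid.coe_mul]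
              rw [Matrix.mul_assoc (Sᴴ * (μ g : Matrix n n ℂ)), hSm]
              simp only [Matrix.mul_assoc] } }
    have hσ (g : G) : σ.mat g = Sᴴ * (μ g : Matrix n n ℂ) * S := rfl
    have hd0 : 0 < d := Nat.pos_of_ne_zero fun h0 => hK0 (Submodule.finrank_eq_zero.mp h0)
    let SL : (Fin d → ℂ) →ₗ[ℂ] EuclideanSpace ℂ n :=
      { toFun := fun x => WithLp.toLp 2 (S *ᵥ x)
        map_add' := fun x y => by rw [Matrix.mulVec_add]; rfl
        map_smul' := fun c x => by rw [Matrix.mulVec_smul]; rfl }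
    have hSLinj : Function.Injective SL := fun x y hxy => by
      have h1 : S *ᵥ x = S *ᵥ y := congrArg WithLp.ofLp hxy
      have h2 := congrArg (fun z => Sᴴ *ᵥ z) h1
      simpa only [Matrix.mulVec_mulVec, hSS, Matrix.one_mulVec] using h2
    have hSLK (x : Fin d → ℂ) : SL x ∈ K := by
      have : SL x = ∑ i, x i • (b i : EuclideanSpace ℂ n) := by
        ext j
        simp [SL, S, Matrix.mulVec, dotProduct, mul_comm]
      rw [this]
      exact Submodule.sum_mem _ fun i _ => Submodule.smul_mem _ _ (b i).2
    have hirr : σ.Irreducible := by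
      rw [UnitaryRep.irreducible_iff]
      refine ⟨hd0, fun P hP => ?_⟩
      by_cases hP0 : P = ⊥
      · exact Or.inl hP0
      right
      have hfr : Module.finrank ℂ (P.map SL) = Module.finrank ℂ P :=
        (Submodule.equivMapOfInjective SL hSLinj P).finrank_eq.symm
      have h1 := hKmin (P.map SL) ⟨?_, ?_, ?_⟩
      · apply Submodule.eq_top_of_finrank_eq
        refine le_antisymm (Submodule.finrank_le P) ?_
        rw [← hfr, Module.finrank_fin_fun]
        exact h1
      · rintro _ ⟨x, -, rfl⟩
        exact hKW (hSLK x)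
      · exact fun h0 => hP0 (
          Submodule.map_injective_of_injective hSLinj (by rw [h0, Submodule.map_bot]))
      · rintro g _ ⟨x, hx, rfl⟩
        refine ⟨σ.mat g *ᵥ x, hP g x hx, ?_⟩
        apply WithLp.ofLp_injective
        change S *ᵥ (σ.mat g *ᵥ x) = (μ g : Matrix n n ℂ) *ᵥ (S *ᵥ x)
        rw [Matrix.mulVec_mulVec, Matrix.mulVec_mulVec, hσ, hSm]
    obtain ⟨ρ, hρ, U, hU1, hU2, hU⟩ := D.exists_equivalent σ hirr
    have hT (g : G) : (S * Uᴴ) * ρ.mat g = (μ g : Matrix n n ℂ) * (S * Uᴴ) := by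
      have h1 : Uᴴ * ρ.mat g = σ.mat g * Uᴴ := by
        calc Uᴴ * ρ.mat g = Uᴴ * (ρ.mat g * U) * Uᴴ := by
              rw [Matrix.mul_assoc, Matrix.mul_assoc, hU2, Matrix.mul_one]
          _ = σ.mat g * Uᴴ := by
              rw [← hU, ← Matrix.mul_assoc Uᴴ, hU1, Matrix.one_mul]
      rw [Matrix.mul_assoc, h1, hσ, ← Matrix.mul_assoc, hSm, Matrix.mul_assoc]
    have hbW (i : Fin d) : (b i : EuclideanSpace ℂ n) ∈ W := by
      have e : (b i : EuclideanSpace ℂ n)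
          = ∑ l, U l i • (WithLp.toLp 2 fun j => (S * Uᴴ) j l : EuclideanSpace ℂ n) := by
        ext j
        have h1 : (S * Uᴴ * U) j i = S j i := by rw [Matrix.mul_assoc, hU1, Matrix.mul_one]
        rw [Matrix.mul_apply] at h1
        change S j i = _
        rw [← h1]
        simp [mul_comm]
      rw [e]
      exact Submodule.sum_mem _ fun l _ =>
        Submodule.smul_mem _ _ (Submodule.subset_span ⟨⟨ρ, hρ⟩, _, l, hT, rfl⟩)
    have h0 : ⟪(b ⟨0, hd0⟩ : EuclideanSpace ℂ n), (b ⟨0, hd0⟩ : EuclideanSpace ℂ n)⟫_ℂ = 0 :=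
      (Submodule.mem_orthogonal _ _).mp (hKW (b ⟨0, hd0⟩).2) _ (hbW _)
    rw [inner_self_eq_zero] at h0
    exact b.orthonormal.ne_zero ⟨0, hd0⟩ (Subtype.ext h0)
  let ℓ : EuclideanSpace ℂ n →ₗ[ℂ] V :=
    { toFun := fun x => ∑ j, x j • a j
      map_add' := fun x y => by simp [add_smul, Finset.sum_add_distrib]
      map_smul' := fun c x => by simp [mul_smul, Finset.smul_sum] }
  have hℓ : W ≤ LinearMap.ker ℓ := by
    rw [Submodule.span_le]
    rintro _ ⟨σ, T, k, hT, rfl⟩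
    exact ha σ T hT k
  funext j
  classical
  have h1 : ℓ (EuclideanSpace.single j 1) = 0 := hℓ (hWtop ▸ Submodule.mem_top)
  simpa [ℓ] using h1

end UnitaryDual

end Fourier

section FourierInversion

namespace UnitaryDual

variable {G : Type*} [Group G] [Fintype G] (D : UnitaryDual G) {V : Type*} [AddCommGroup V]
  [Module ℂ V]

/-- A function on `G` is determined by its Fourier transform. -/
theorem ext_of_forall_sum_eq {f f' : G → V} (h : ∀ (π : D.Elt) (i j : D.Idx π),
    ∑ g, π.1.mat g i j • f g = ∑ g, π.1.mat g i j • f' g) : f = f' := by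
  classical
  -- the left regular representation
  let L (g : G) : Matrix G G ℂ := Matrix.of fun x y => if x = g * y then 1 else 0
  have hL (g k : G) : L g * L k = L (g * k) := by
    ext x y
    simp [L, Matrix.mul_apply, mul_assoc]
  have hL1 : L 1 = 1 := by
    ext x y
    simp [L, Matrix.one_apply]
  have hLs (g : G) : (L g)ᴴ = L g⁻¹ := by
    ext x y
    simp only [L, Matrix.conjTranspose_apply, Matrix.of_apply, eq_inv_mul_iff_mul_eq]
    by_cases h1 : g * x = y
    · rw [if_pos h1.symm, if_pos h1, star_one]
    · rw [if_neg (Ne.symm h1), if_neg h1, star_zero]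
  let μ : G →* Matrix.unitaryGroup G ℂ :=
    { toFun := fun g => ⟨L g, by
        rw [Matrix.mem_unitaryGroup_iff, Matrix.star_eq_conjTranspose, hLs,
          hL, mul_inv_cancel, hL1]⟩
      map_one' := Subtype.ext hL1
      map_mul' := fun g k => Subtype.ext (hL g k).symm }
  have key := D.eq_zero_of_forall_intertwiner μ (fun x => f x⁻¹ - f' x⁻¹) fun σ T hT k => by
    have h1 (x : G) : T x k = ∑ l, T 1 l * σ.1.mat x⁻¹ l k := by
      have h2 := congrFun (congrFun (hT x⁻¹) 1) k
      rw [Matrix.mul_apply, Matrix.mul_apply] at h2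
      rw [h2, Finset.sum_eq_single x]
      · simp [μ, L]
      · intro y _ hy
        have : ¬ (1 : G) = x⁻¹ * y := fun h3 => hy (inv_mul_eq_one.mp h3.symm).symm
        simp [μ, L, this]
      · simp
    calc ∑ x, T x k • (f x⁻¹ - f' x⁻¹)
        = ∑ l, T 1 l • ∑ x, σ.1.mat x⁻¹ l k • (f x⁻¹ - f' x⁻¹) := by
          simp only [h1, Finset.sum_smul, Finset.smul_sum, mul_smul]
          exact Finset.sum_comm
      _ = 0 := by
          refine Finset.sum_eq_zero fun l _ => ?_
          have h2 : ∑ x, σ.1.mat x⁻¹ l k • (f x⁻¹ - f' x⁻¹) = 0 := by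
            have h3 := Equiv.sum_comp (Equiv.inv G) fun x => σ.1.mat x l k • (f x - f' x)
            simp only [smul_sub, Finset.sum_sub_distrib, h σ l k, sub_self, Equiv.inv_apply] at h3 ⊢
            exact h3
          exact (congrArg (T 1 l • ·) h2).trans (smul_zero _)
  funext g
  have := congrFun key g⁻¹
  simpa [sub_eq_zero] using this

omit [Fintype G] in
theorem dim_pos (π : D.Elt) : 0 < π.1.dim :=
  ((UnitaryRep.irreducible_iff π.1).mp (D.irreducible _ π.2)).1

omit [Fintype G] in
theorem not_equivalent_of_ne {π ρ : D.Elt} (h : π ≠ ρ) : ¬ π.1.Equivalent ρ.1 :=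
  fun he => h (Subtype.ext (D.eq_of_equivalent _ π.2 _ ρ.2 he))

instance finite_elt : Finite D.Elt := by
  let v (π : D.Elt) : EuclideanSpace ℂ G :=
    WithLp.toLp 2 fun g => π.1.mat g ⟨0, D.dim_pos π⟩ ⟨0, D.dim_pos π⟩
  have hinner (π ρ : D.Elt) : ⟪v π, v ρ⟫_ℂ
      = ∑ g, ρ.1.mat g ⟨0, D.dim_pos ρ⟩ ⟨0, D.dim_pos ρ⟩
          * star (π.1.mat g ⟨0, D.dim_pos π⟩ ⟨0, D.dim_pos π⟩) := by
    rw [PiLp.inner_apply]; rfl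
  have hli : LinearIndependent ℂ v := by
    refine linearIndependent_of_ne_zero_of_inner_eq_zero (𝕜 := ℂ) (fun π h0 => ?_) fun π ρ hne => ?_
    · have h1 := (D.irreducible _ π.2).sum_mul_star ⟨0, D.dim_pos π⟩ ⟨0, D.dim_pos π⟩
        ⟨0, D.dim_pos π⟩ ⟨0, D.dim_pos π⟩
      rw [← hinner, h0, inner_zero_left] at h1
      simp only [and_self, if_true, mul_zero] at h1
      exact Nat.cast_ne_zero.mpr Fintype.card_ne_zero h1.symm
    · change ⟪v π, v ρ⟫_ℂ = 0
      rw [hinner]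
      exact (D.irreducible _ π.2).sum_mul_star_of_not_equivalent (D.irreducible _ ρ.2)
        (D.not_equivalent_of_ne hne) _ _ _ _
  exact hli.finite

/-- The inverse Fourier transform: the function `f` on `G` such that `∑ g, f g ⊗ π(g) = B π` for
all `π`. -/
def fourierInv (B : ∀ π : D.Elt, Matrix (D.Idx π) (D.Idx π) V) (g : G) : V :=
  ∑ᶠ π : D.Elt, ((π.1.dim : ℂ) / Fintype.card G) • ∑ k, ∑ l, star (π.1.mat g k l) • B π k l

theorem sum_smul_fourierInv (B : ∀ π : D.Elt, Matrix (D.Idx π) (D.Idx π) V) (ρ : D.Elt)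
    (i j : D.Idx ρ) : ∑ g, ρ.1.mat g i j • D.fourierInv B g = B ρ i j := by
  classical
  have := Fintype.ofFinite D.Elt
  have hG : (Fintype.card G : ℂ) ≠ 0 := Nat.cast_ne_zero.mpr Fintype.card_ne_zero
  simp only [fourierInv, finsum_eq_sum_of_fintype]
  have h1 : ∑ g, ρ.1.mat g i j • ∑ π : D.Elt, ((π.1.dim : ℂ) / Fintype.card G) •
        ∑ k, ∑ l, star (π.1.mat g k l) • B π k l
      = ∑ π : D.Elt, ∑ k, ∑ l, (((π.1.dim : ℂ) / Fintype.card G) *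
        ∑ g, ρ.1.mat g i j * star (π.1.mat g k l)) • B π k l := by
    simp only [Finset.smul_sum, Finset.mul_sum, Finset.sum_smul, smul_smul]
    rw [Finset.sum_comm]
    refine Finset.sum_congr rfl fun π _ => ?_
    rw [Finset.sum_comm]
    refine Finset.sum_congr rfl fun k _ => ?_
    rw [Finset.sum_comm]
    refine Finset.sum_congr rfl fun l _ => Finset.sum_congr rfl fun g _ => ?_
    congr 1; ring
  rw [h1, Finset.sum_eq_single ρ]
  · have h2 (k l : D.Idx ρ) : ((ρ.1.dim : ℂ) / Fintype.card G) *
        ∑ g, ρ.1.mat g i j * star (ρ.1.mat g k l) = if i = k ∧ j = l then 1 else 0 := by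
      rw [div_mul_eq_mul_div, (D.irreducible _ ρ.2).sum_mul_star]
      split_ifs
      · exact div_self hG
      · exact zero_div _
    simp only [h2]
    rw [Finset.sum_eq_single i, Finset.sum_eq_single j]
    · simp
    · intro l _ hl
      rw [if_neg fun h => hl h.2.symm, zero_smul]
    · simp
    · intro k _ hk
      exact Finset.sum_eq_zero fun l _ => by rw [if_neg fun h => hk h.1.symm, zero_smul]
    · simp
  · intro π _ hne
    refine Finset.sum_eq_zero fun k _ => Finset.sum_eq_zero fun l _ => ?_
    rw [(D.irreducible _ π.2).sum_mul_star_of_not_equivalent (D.irreducible _ ρ.2)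
      (D.not_equivalent_of_ne hne), mul_zero, zero_smul]
  · simp

end UnitaryDual

end FourierInversion

section Transform

namespace UnitaryDual

variable {G : Type*} [Group G] [Fintype G] (D : UnitaryDual G)

/-- The Fourier transform `π ↦ ∑ g, f g ⊗ π(g)` of a vector-valued function `f` on `G`. -/
def fourier {V : Type*} [AddCommGroup V] [Module ℂ V] (f : G → V) (π : D.Elt) :
    Matrix (D.Idx π) (D.Idx π) V :=
  Matrix.of fun i j => ∑ g, π.1.mat g i j • f g

section Module

variable {V : Type*} [AddCommGroup V] [Module ℂ V]

theorem fourier_apply (f : G → V) (π : D.Elt) (i j : D.Idx π) :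
    D.fourier f π i j = ∑ g, π.1.mat g i j • f g := rfl

theorem fourier_injective {f f' : G → V} (h : ∀ π, D.fourier f π = D.fourier f' π) : f = f' :=
  D.ext_of_forall_sum_eq fun π i j => congrFun (congrFun (h π) i) j

theorem fourier_fourierInv (B : ∀ π : D.Elt, Matrix (D.Idx π) (D.Idx π) V) (π : D.Elt) :
    D.fourier (D.fourierInv B) π = B π := by
  ext i j
  exact D.sum_smul_fourierInv B π i j

theorem fourier_single [DecidableEq G] (h : G) (x : V) (π : D.Elt) :
    D.fourier (fun g => if g = h then x else 0) π = Matrix.of fun i j => π.1.mat h i j • x := by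
  ext i j
  simp [fourier_apply]

end Module

variable {A : Type*} [Ring A] [StarRing A] [Algebra ℂ A] [StarModule ℂ A]

omit [StarRing A] [StarModule ℂ A] in
/-- The Fourier transform turns convolution into multiplication. -/
theorem fourier_mul (f f' : G → A) (π : D.Elt) :
    D.fourier f π * D.fourier f' π = D.fourier (fun l => ∑ a, f a * f' (a⁻¹ * l)) π := by
  ext i j
  simp only [Matrix.mul_apply, fourier_apply, Finset.sum_mul_sum, Finset.smul_sum,
    smul_mul_smul_comm]
  rw [Finset.sum_comm]
  conv_rhs => rw [Finset.sum_comm]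
  refine Finset.sum_congr rfl fun a _ => ?_
  rw [Finset.sum_comm]
  refine Fintype.sum_equiv (Equiv.mulLeft a) _ _ fun h => ?_
  rw [← Finset.sum_smul, Equiv.coe_mulLeft, inv_mul_cancel_left, UnitaryRep.mat_mul,
    Matrix.mul_apply]

theorem star_fourier (f : G → A) (π : D.Elt) :
    star (D.fourier f π) = D.fourier (fun g => star (f g⁻¹)) π := by
  ext i j
  rw [Matrix.star_apply, fourier_apply, fourier_apply, star_sum]
  refine Fintype.sum_equiv (Equiv.inv G) _ _ fun g => ?_
  rw [star_smul, Equiv.inv_apply, inv_inv, UnitaryRep.mat_inv, Matrix.conjTranspose_apply]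

omit [StarRing A] [StarModule ℂ A] in
theorem fourier_one [DecidableEq G] (π : D.Elt) :
    D.fourier (fun g => if g = 1 then (1 : A) else 0) π = 1 := by
  rw [fourier_single, UnitaryRep.mat_one]
  ext i j
  simp [Matrix.one_apply]

theorem sum_eq_fourier_triv {V : Type*} [AddCommGroup V] [Module ℂ V] (f : G → V)
    (i j : D.Idx D.triv) : ∑ g, f g = D.fourier f D.triv i j := by
  rw [fourier_apply]
  refine Finset.sum_congr rfl fun g _ => ?_
  have : D.triv.1.mat g = 1 := rfl
  have hij : i = j := Subsingleton.elim (α := Fin 1) i j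
  rw [this, hij, Matrix.one_apply_eq, one_smul]

end UnitaryDual

end Transform

/-! ### The grading given by an action of the dual -/

section Components

variable {G : Type*} [Group G] [Fintype G] {H : Type*} [NormedAddCommGroup H]
  [InnerProductSpace ℂ H] [CompleteSpace H] {D : UnitaryDual G} {M : VonNeumannAlgebra H}

/-- A matrix over `M` indexed by `H_π ⊗ H_ρ` is determined by its products with all
`T ∈ (σ, π ⊗ ρ)`. -/
theorem UnitaryDual.eq_sum_kronecker_of_intertwiners (π ρ : D.Elt)
    (C : Matrix (D.Idx π × D.Idx ρ) (D.Idx π × D.Idx ρ) M.Elt) (f : G → M.Elt)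
    (hC : ∀ (σ : D.Elt) (T : Matrix (D.Idx π × D.Idx ρ) (D.Idx σ) ℂ),
      σ.1.IsIntertwinerToTensor π.1 ρ.1 T → C * oneTensor M T = oneTensor M T * D.fourier f σ)
    (r p : D.Idx π × D.Idx ρ) :
    C r p = ∑ g, (π.1.mat g r.1 p.1 * ρ.1.mat g r.2 p.2) • f g := by
  let μ : G →* Matrix.unitaryGroup (D.Idx π × D.Idx ρ) ℂ :=
    { toFun := fun g => ⟨π.1.mat g ⊗ₖ ρ.1.mat g,
        Matrix.kronecker_mem_unitary (π.1.toHom g).2 (ρ.1.toHom g).2⟩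
      map_one' := Subtype.ext (by simp only [UnitaryRep.mat_one]; exact Matrix.one_kronecker_one)
      map_mul' := fun g h => Subtype.ext (by
        simp only [UnitaryRep.mat_mul]; exact Matrix.mul_kronecker_mul _ _ _ _) }
  have key := D.eq_zero_of_forall_intertwiner μ
    (fun p => C r p - ∑ g, (π.1.mat g r.1 p.1 * ρ.1.mat g r.2 p.2) • f g) fun σ T hT k => by
      have h1 := congrFun (congrFun (hC σ T hT) r) k
      rw [Matrix.mul_apply, Matrix.mul_apply] at h1
      have h2 : ∑ p, T p k • C r p = ∑ g, (T * σ.1.mat g) r k • f g := by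
        calc ∑ p, T p k • C r p = ∑ p, C r p * oneTensor M T p k := by
              refine Finset.sum_congr rfl fun p _ => ?_
              rw [oneTensor, Matrix.map_apply, ← Algebra.commutes, Algebra.smul_def]
          _ = ∑ l, T r l • D.fourier f σ l k := by
              rw [h1]
              refine Finset.sum_congr rfl fun l _ => ?_
              rw [oneTensor, Matrix.map_apply, Algebra.smul_def]
          _ = _ := by
              simp only [UnitaryDual.fourier_apply, Finset.smul_sum, smul_smul, Matrix.mul_apply,
                Finset.sum_smul]
              exact Finset.sum_comm
      simp only [smul_sub, Finset.sum_sub_distrib, h2, hT, Finset.smul_sum, smul_smul]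
      rw [sub_eq_zero, Finset.sum_comm]
      refine Finset.sum_congr rfl fun g _ => ?_
      rw [← Finset.sum_smul, Matrix.mul_apply]
      congr 1
      refine Finset.sum_congr rfl fun p _ => ?_
      simp [μ, mul_comm]
  exact sub_eq_zero.mp (congrFun key p)

namespace DualAction

variable (α : DualAction D M)

/-- The homogeneous components of `M` for an action `α` of the dual of `G`: they are determined by
`α_π(x) = ∑ g, component g x ⊗ π(g)`. -/
def component (g : G) : M.Elt →ₗ[ℂ] M.Elt where
  toFun x := D.fourierInv (fun π => α.map π x) g
  map_add' x y := by
    refine congrFun (D.fourier_injective (f' := D.fourierInv (fun π => α.map π x) +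
      D.fourierInv (fun π => α.map π y)) fun π => ?_) g
    rw [D.fourier_fourierInv]
    ext1 i j
    simp only [D.fourier_apply, Pi.add_apply, smul_add, Finset.sum_add_distrib,
      D.sum_smul_fourierInv, map_add, Matrix.add_apply]
  map_smul' c x := by
    refine congrFun (D.fourier_injective (f' := c • D.fourierInv (fun π => α.map π x))
      fun π => ?_) g
    rw [D.fourier_fourierInv]
    ext1 i j
    simp only [D.fourier_apply, Pi.smul_apply, smul_comm _ c, ← Finset.smul_sum,
      D.sum_smul_fourierInv, map_smul, Matrix.smul_apply]

theorem fourier_component (x : M.Elt) (π : D.Elt) :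
    D.fourier (fun g => α.component g x) π = α.map π x :=
  D.fourier_fourierInv (fun π => α.map π x) π

theorem map_apply_eq_sum (x : M.Elt) (π : D.Elt) (i j : D.Idx π) :
    α.map π x i j = ∑ g, π.1.mat g i j • α.component g x := by
  rw [← fourier_component, D.fourier_apply]

theorem map_sum_smul_apply {π : D.Elt} (c : G → ℂ) (y : G → M.Elt) (i j : D.Idx π) :
    α.map π (∑ g, c g • y g) i j = ∑ g, c g • α.map π (y g) i j := by
  rw [map_sum, Matrix.sum_apply]
  simp only [map_smul, Matrix.smul_apply]

theorem sum_component (x : M.Elt) : ∑ g, α.component g x = x := by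
  rw [D.sum_eq_fourier_triv _ (0 : Fin 1) (0 : Fin 1), fourier_component, α.map_triv]
  exact Matrix.diagonal_apply_eq (fun _ : Fin 1 => x) 0

/-- The components are homogeneous: `α_π(x_h) = x_h ⊗ π(h)`. -/
theorem map_component_apply (h : G) (x : M.Elt) (π : D.Elt) (i j : D.Idx π) :
    α.map π (α.component h x) i j = π.1.mat h i j • α.component h x := by
  refine congrFun (D.fourier_injective (f := fun h => α.map π (α.component h x) i j)
    (f' := fun h => π.1.mat h i j • α.component h x) fun ρ => ?_) h
  ext1 k l
  have h1 := UnitaryDual.eq_sum_kronecker_of_intertwiners π ρ (tensorId (α.map π) (α.map ρ x))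
    (fun g => α.component g x) (fun σ T hT => by rw [fourier_component, α.map_tensor π ρ σ T hT])
    (i, k) (j, l)
  simp only [D.fourier_apply, smul_smul]
  rw [← map_sum_smul_apply, ← map_apply_eq_sum]
  refine h1.trans (Finset.sum_congr rfl fun g _ => ?_)
  rw [mul_comm]

theorem component_component [DecidableEq G] (g h : G) (x : M.Elt) :
    α.component g (α.component h x) = if g = h then α.component h x else 0 := by
  refine congrFun (D.fourier_injective (f := fun g => α.component g (α.component h x))
    (f' := fun g => if g = h then α.component h x else 0) fun π => ?_) g
  rw [fourier_component, D.fourier_single]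
  ext1 i j
  exact α.map_component_apply h x π i j

theorem component_mul (l : G) (x y : M.Elt) :
    α.component l (x * y) = ∑ g, α.component g x * α.component (g⁻¹ * l) y := by
  refine congrFun (D.fourier_injective (f := fun l => α.component l (x * y))
    (f' := fun l => ∑ g, α.component g x * α.component (g⁻¹ * l) y) fun π => ?_) l
  rw [← D.fourier_mul (fun g => α.component g x) fun g => α.component g y]
  simp only [fourier_component, map_mul]

theorem component_star (g : G) (x : M.Elt) :
    α.component g (star x) = star (α.component g⁻¹ x) := by
  refine congrFun (D.fourier_injective (f := fun g => α.component g (star x))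
    (f' := fun g => star (α.component g⁻¹ x)) fun π => ?_) g
  rw [← D.star_fourier (fun g => α.component g x)]
  simp only [fourier_component, map_star]

theorem component_one [DecidableEq G] (g : G) :
    α.component g 1 = if g = 1 then 1 else 0 := by
  refine congrFun (D.fourier_injective (f := fun g => α.component g 1)
    (f' := fun g => if g = 1 then (1 : M.Elt) else 0) fun π => ?_) g
  rw [fourier_component, D.fourier_one, map_one]

theorem isGrading [DecidableEq G] : IsGrading α.component :=
  ⟨α.sum_component, α.component_component, α.component_mul, α.component_star, α.component_one⟩

/-- An outer action gives a free grading: an intertwiner `b` gives, for each `π ≠ 𝟏`, the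
intertwiner `∑ h, b h ⊗ π(h⁻¹)` between `x ⊗ 1` and `α_π(x)`. -/
theorem IsOuter.isFreeGrading (hα : α.IsOuter) : IsFreeGrading α.component := by
  intro b hb
  have hzero (π : D.Elt) (hπ : π ≠ D.triv) : D.fourier (fun g => b g⁻¹) π = 0 := by
    refine hα.2 π hπ _ fun x => ?_
    rw [← fourier_component, D.fourier_mul]
    ext1 i j
    rw [Matrix.scalar_apply, Matrix.mul_diagonal, D.fourier_apply, D.fourier_apply, Finset.sum_mul]
    refine Finset.sum_congr rfl fun l _ => ?_
    rw [smul_mul_assoc, ← hb x l⁻¹]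
    congr 1
    refine Fintype.sum_equiv (Equiv.mulLeft l⁻¹) _ _ fun a => ?_
    simp
  -- only the trivial Fourier coefficient of `b` survives, and it is invariant under translation
  have hconst (t : G) : b 1 = b t := by
    have := congrFun (D.fourier_injective (f := fun g => b g⁻¹) (f' := fun g => b (g⁻¹ * t))
      fun π => ?_) 1
    · simpa using this
    · by_cases hπ : π = D.triv
      · subst hπ
        ext1 i j
        rw [← D.sum_eq_fourier_triv, ← D.sum_eq_fourier_triv]
        exact Fintype.sum_equiv (Equiv.mulLeft t) _ _ fun g => by simp
      · rw [hzero π hπ]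
        ext1 i j
        have h1 : D.fourier (fun g => b (g⁻¹ * t)) π i j
            = ∑ l, π.1.mat t i l • D.fourier (fun g => b g⁻¹) π l j := by
          simp only [D.fourier_apply, Finset.smul_sum, smul_smul]
          rw [Finset.sum_comm]
          refine Fintype.sum_equiv (Equiv.mulLeft t⁻¹) _ _ fun g => ?_
          rw [← Finset.sum_smul, ← Matrix.mul_apply, ← UnitaryRep.mat_mul]
          simp
        rw [h1, hzero π hπ]
        simp
  obtain ⟨c, hc⟩ := hα.1 (b 1) fun x => by
    rw [← hb x 1]
    simp only [gradingRep, LinearMap.coe_mk, AddHom.coe_mk, inv_one, one_mul, ← hconst]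
    rw [← Finset.sum_mul, α.sum_component]
  exact ⟨c, fun h => by rw [← hconst h, hc, Algebra.algebraMap_eq_smul_one]⟩

end DualAction

end Components

/-! ### Vanishing of cohomology -/

section Vanishing

variable {G : Type*} [Group G] [Fintype G] {H : Type*} [NormedAddCommGroup H]
  [InnerProductSpace ℂ H] [CompleteSpace H] {D : UnitaryDual G} {M : VonNeumannAlgebra H}
  {α : DualAction D M} {w : ∀ π : D.Elt, Matrix (D.Idx π) (D.Idx π) M.Elt}

namespace DualAction.IsUnitaryOneCocycle

theorem sum_fourierInv (hw : α.IsUnitaryOneCocycle w) : ∑ g, D.fourierInv w g = 1 := by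
  rw [D.sum_eq_fourier_triv _ (0 : Fin 1) (0 : Fin 1), D.fourier_fourierInv, hw.triv]
  exact Matrix.one_apply_eq (0 : Fin 1)

/-- Unitarity of `w`, as an orthogonality relation. -/
theorem sum_mul_star_fourierInv [DecidableEq G] (hw : α.IsUnitaryOneCocycle w) (g : G) :
    ∑ k, D.fourierInv w (g * k) * star (D.fourierInv w k) = if g = 1 then 1 else 0 := by
  have h1 := congrFun (D.fourier_injective
    (f := fun l => ∑ a, D.fourierInv w a * star (D.fourierInv w (a⁻¹ * l)⁻¹))
    (f' := fun g => if g = 1 then (1 : M.Elt) else 0) fun π => by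
      rw [D.fourier_one, ← D.fourier_mul (D.fourierInv w) (fun g => star (D.fourierInv w g⁻¹)),
        ← D.star_fourier, D.fourier_fourierInv]
      exact (Unitary.mem_iff.mp (hw.unitary π)).2) g
  rw [← h1]
  refine Fintype.sum_equiv (Equiv.mulLeft g) _ _ fun k => ?_
  simp

/-- The cocycle identity after Fourier inversion: `w_π α_π(w_h) = w_h ⊗ π(h)` for
`w_h = D.fourierInv w h`. -/
theorem mul_map_fourierInv (hw : α.IsUnitaryOneCocycle w) (h : G) (π : D.Elt) (i j : D.Idx π) :
    (w π * α.map π (D.fourierInv w h)) i j = π.1.mat h i j • D.fourierInv w h := by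
  refine congrFun (D.fourier_injective
    (f := fun h => (w π * α.map π (D.fourierInv w h)) i j)
    (f' := fun h => π.1.mat h i j • D.fourierInv w h) fun ρ => ?_) h
  ext1 k l
  have h1 := UnitaryDual.eq_sum_kronecker_of_intertwiners π ρ
    ((w π ⊗ₖ (1 : Matrix (D.Idx ρ) (D.Idx ρ) M.Elt)) * tensorId (α.map π) (w ρ)) (D.fourierInv w)
    (fun σ T hT => by rw [D.fourier_fourierInv, hw.cocycle π ρ σ T hT]) (i, k) (j, l)
  have h2 : ((w π ⊗ₖ (1 : Matrix (D.Idx ρ) (D.Idx ρ) M.Elt)) *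
        tensorId (α.map π) (w ρ)) (i, k) (j, l)
      = ∑ m, w π i m * α.map π (w ρ k l) m j := by
    rw [Matrix.mul_apply, Fintype.sum_prod_type]
    refine Finset.sum_congr rfl fun m _ => ?_
    rw [Finset.sum_eq_single k]
    · simp [tensorId]
    · intro b _ hb
      simp [tensorId, Matrix.one_apply_ne hb.symm]
    · simp
  rw [h2] at h1
  have h3 (m : D.Idx π) : α.map π (w ρ k l) m j
      = ∑ g, ρ.1.mat g k l • α.map π (D.fourierInv w g) m j := by
    rw [← α.map_sum_smul_apply, D.sum_smul_fourierInv]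
  simp only [h3] at h1
  simp only [D.fourier_apply, smul_smul, Matrix.mul_apply]
  calc ∑ g, ρ.1.mat g k l • ∑ m, w π i m * α.map π (D.fourierInv w g) m j
      = ∑ m, w π i m * ∑ g, ρ.1.mat g k l • α.map π (D.fourierInv w g) m j := by
        simp only [Finset.smul_sum, Finset.mul_sum, mul_smul_comm]
        exact Finset.sum_comm
    _ = _ := h1
    _ = _ := Finset.sum_congr rfl fun g _ => by rw [mul_comm]

/-- The cocycle identity as a relation in `M`, for `w_g = D.fourierInv w g`: the two sides are the
values at `g⁻¹ h` of functions with the same Fourier transform, `w_π* (w_h ⊗ π(h)) = α_π(w_h)`. -/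
theorem star_mul_fourierInv (hw : α.IsUnitaryOneCocycle w) (g h : G) :
    star (D.fourierInv w g) * D.fourierInv w h = α.component (g⁻¹ * h) (D.fourierInv w h) := by
  classical
  have h1 := congrFun (D.fourier_injective
    (f := fun k => ∑ a, star (D.fourierInv w a⁻¹) * (if a⁻¹ * k = h then D.fourierInv w h else 0))
    (f' := fun k => α.component k (D.fourierInv w h)) fun π => by
      rw [← D.fourier_mul (fun g => star (D.fourierInv w g⁻¹))
        (fun k => if k = h then D.fourierInv w h else 0), ← D.star_fourier, D.fourier_fourierInv,
        α.fourier_component, D.fourier_single]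
      have h2 : (Matrix.of fun i j => π.1.mat h i j • D.fourierInv w h)
          = w π * α.map π (D.fourierInv w h) := by
        ext1 i j
        exact (hw.mul_map_fourierInv h π i j).symm
      rw [h2, ← Matrix.mul_assoc, (Unitary.mem_iff.mp (hw.unitary π)).1, Matrix.one_mul])
    (g⁻¹ * h)
  rw [← h1, Finset.sum_eq_single g⁻¹]
  · simp
  · intro a _ ha
    rw [if_neg, mul_zero]
    intro h2
    apply ha
    rw [← mul_assoc, mul_eq_right, inv_mul_eq_one] at h2
    exact h2
  · simp

end DualAction.IsUnitaryOneCocycle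

end Vanishing

end

theorem mainTheorem3 {G : Type*} [Group G] [Finite G] (D : UnitaryDual G)
    {H : Type*} [NormedAddCommGroup H] [InnerProductSpace ℂ H] [CompleteSpace H]
    (M : VonNeumannAlgebra H) (hM : M.IsTypeIIOneFactor)
    (α : DualAction D M) (hα : α.IsOuter)
    (w : ∀ π : D.Elt, Matrix (D.Idx π) (D.Idx π) M.Elt) (hw : α.IsUnitaryOneCocycle w) :
    α.IsCoboundary w := by
  classical
  have := Fintype.ofFinite G
  obtain ⟨τ, hτ⟩ := hM.exists_trace
  obtain ⟨ι, hι⟩ := hτ.exists_isCompleteTrace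
  obtain ⟨v, hv, hvw⟩ := hι.exists_unitary_of_cocycle
    (fun x hx => by simpa only [Algebra.algebraMap_eq_smul_one] using hM.isFactor x hx)
    α.isGrading hα.isFreeGrading hw.sum_fourierInv hw.sum_mul_star_fourierInv hw.star_mul_fourierInv
  refine ⟨v, hv, fun π => ?_⟩
  ext1 i j
  rw [Matrix.scalar_apply, Matrix.diagonal_mul, α.map_apply_eq_sum]
  simp only [hvw]
  rw [← D.sum_smul_fourierInv w π i j, Finset.mul_sum]
  refine Finset.sum_congr rfl fun g _ => ?_
  rw [mul_smul_comm, ← mul_assoc, (Unitary.mem_iff.mp hv).1, one_mul]
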